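/- Theorem (Joyal's theorem for regular theories). Let $\Sigma$ be a single-sorted first-order signature (relation symbols and function symbols of finite arities, including constants; no restriction on the number of symbols, and equality of symbols need not be decidable). Let $\mathbb{T}$ be a regular theory over $\Sigma$, i.e. a set of sequents $\phi\vdash_{\mathbf{x}}\psi$ whose formulas are built from atomic formulas (including equations) by $\top,\wedge,\exists$. Provability is in regular logic with contexts, in which domains are not assumed to be inhabited. Let $\mathrm{Mod}(\mathbb{T})$ be the category of Tarski models of $\mathbb{T}$ (with possibly empty domains) and homomorphisms. For a model $M$, let $\mathbb{T}_M$ be the theory over $\Sigma\cup\{\text{a constant for each } d\in M\}$ obtained from $\mathbb{T}$ by adding the axioms $\top\vdash\phi[\mathbf{d}/\mathbf{x}]$ for all Horn formulas $\phi$ (finite conjunctions of atomic formulas) and all tuples $\mathbf{d}$ of elements of $M$ with $M\vDash\phi[\mathbf{d}]$. Let $\mathcal{M}$ be a full subcategory of $\mathrm{Mod}(\mathbb{T})$ that is strongly conservative: every regular sequent over $\Sigma$ that is true in all models in $\mathcal{M}$ is provable in $\mathbb{T}$; and, for every $M\in\mathcal{M}$, every regular sequent over the extended signature that is true in all models of $\mathbb{T}_M$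 whose $\Sigma$-reducts are in $\mathcal{M}$ is provable in $\mathbb{T}_M$. Let $\mathcal{C}_{\mathbb{T}}$ be the syntactic category of $\mathbb{T}$, whose objects are the regular formulas in context $[\mathbf{x}\mid\phi]$ up to $\alpha$-equivalence and whose morphisms are the $\mathbb{T}$-provable-equivalence classes of $\mathbb{T}$-provably functional regular formulas, and let $$\mathrm{Ev}:\mathcal{C}_{\mathbb{T}}\to\mathbf{Set}^{\mathcal{M}},\qquad \mathrm{Ev}([\mathbf{x}\mid\phi])(M)=\{\mathbf{d}\in M^{\mathbf{x}} : M\vDash\phi[\mathbf{d}]\},$$ be the evaluation functor. Then: (a) $\mathrm{Ev}$ is conservative, i.e. it is faithful and reflects isomorphisms; (b) $\mathrm{Ev}$ is conditionally sub-Heyting, i.e. $\mathcal{C}_{\mathbb{T}}$ is a regular category, $\mathrm{Ev}$ is a regular functor (it preserves finite limits and regular epimorphisms), and, for every morphism $f:A\to B$ of $\mathcal{C}_{\mathbb{T}}$ for which the pullback functor $f^{*}:\mathrm{Sub}(B)\to\mathrm{Sub}(A)$ has a right adjoint $\forall_f$, the pullback functor $\mathrm{Ev}(f)^{*}$ in $\mathbf{Set}^{\mathcal{M}}$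 has a right adjoint $\forall_{\mathrm{Ev}(f)}$ and $\mathrm{Ev}(\forall_f(S))=\forall_{\mathrm{Ev}(f)}(\mathrm{Ev}(S))$ for all $S\in\mathrm{Sub}(A)$. -/

import Mathlib

open CategoryTheory FirstOrder FirstOrder.Language

universe u v w u₁ v₁ u₂ v₂

namespace RegularLogic

/-! ### Regular formulas in context, sequents, and derivability -/

/-- Regular formulas in context over a single-sorted signature `L` (function and relation symbols
of arbitrary finite arities). `RegFormula L n` consists of the formulas in a context of `n`
variables, indexed by `Fin n`; `ex` binds the last variable of its context `n + 1`. Formulas are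
nameless, so they are automatically identified up to `α`-equivalence. -/
inductive RegFormula (L : FirstOrder.Language.{u, v}) : ℕ → Type (max u v)
  | top {n : ℕ} : RegFormula L n
  | equal {n : ℕ} (t s : L.Term (Fin n)) : RegFormula L n
  | rel {n k : ℕ} (R : L.Relations k) (ts : Fin k → L.Term (Fin n)) : RegFormula L n
  | and {n : ℕ} (φ ψ : RegFormula L n) : RegFormula L n
  | ex {n : ℕ} (φ : RegFormula L (n + 1)) : RegFormula L n

namespace RegFormula

variable {L : FirstOrder.Language.{u, v}}

/-- The substitution obtained from `σ` by adding one bound variable. -/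
def lift {n m : ℕ} (σ : Fin n → L.Term (Fin m)) : Fin (n + 1) → L.Term (Fin (m + 1)) :=
  Fin.snoc (α := fun _ => L.Term (Fin (m + 1)))
    (fun i => (σ i).subst fun j => Term.var j.castSucc) (Term.var (Fin.last m))

/-- Simultaneous capture-avoiding substitution of terms for the variables of the context. -/
def subst : {n m : ℕ} → RegFormula L n → (Fin n → L.Term (Fin m)) → RegFormula L m
  | _, _, top, _ => top
  | _, _, equal t s, σ => equal (t.subst σ) (s.subst σ)
  | _, _, rel R ts, σ => rel R fun i => (ts i).subst σ
  | _, _, and φ ψ, σ => and (φ.subst σ) (ψ.subst σ)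
  | _, _, ex φ, σ => ex (φ.subst (lift σ))

/-- Weakening of the context by `k` further variables, added at the end. -/
def wk {n : ℕ} (k : ℕ) (φ : RegFormula L n) : RegFormula L (n + k) :=
  φ.subst fun i => Term.var (Fin.castAdd k i)

/-- Existential quantification over the last `k` variables of the context. -/
def exs {n : ℕ} : (k : ℕ) → RegFormula L (n + k) → RegFormula L n
  | 0, φ => φ
  | k + 1, φ => exs k (ex φ)

/-- The conjunction of the equations `t j = s j`. -/
def eqs {n : ℕ} : (k : ℕ) → (t s : Fin k → L.Term (Fin n)) → RegFormula L n
  | 0, _, _ => top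
  | k + 1, t, s =>
    and (eqs k (fun j => t j.castSucc) fun j => s j.castSucc)
      (equal (t (Fin.last k)) (s (Fin.last k)))

/-- Horn formulas: conjunctions of atomic formulas. -/
def IsHorn : {n : ℕ} → RegFormula L n → Prop
  | _, top => True
  | _, equal _ _ => True
  | _, rel _ _ => True
  | _, and φ ψ => φ.IsHorn ∧ ψ.IsHorn
  | _, ex _ => False

/-- Translation of formulas along a map of signatures. -/
def onLHom {L' : FirstOrder.Language.{u₁, v₁}} (F : L →ᴸ L') : {n : ℕ} → RegFormula L n → RegFormula L' n
  | _, top => top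
  | _, equal t s => equal (F.onTerm t) (F.onTerm s)
  | _, rel R ts => rel (F.onRelation R) fun i => F.onTerm (ts i)
  | _, and φ ψ => and (φ.onLHom F) (ψ.onLHom F)
  | _, ex φ => ex (φ.onLHom F)

/-- Tarski semantics. The domain may be empty. -/
def Realize {M : Type w} [L.Structure M] : {n : ℕ} → RegFormula L n → (Fin n → M) → Prop
  | _, top, _ => True
  | _, equal t s, x => t.realize x = s.realize x
  | _, rel R ts, x => Structure.RelMap R fun i => (ts i).realize x
  | _, and φ ψ, x => φ.Realize x ∧ ψ.Realize x
  | _, ex φ, x => ∃ a : M, φ.Realize (Fin.snoc (α := fun _ => M) x a)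

end RegFormula

/-- Regular sequents `φ ⊢ ψ` in a context of `ctx` variables. -/
structure Sequent (L : FirstOrder.Language.{u, v}) where
  ctx : ℕ
  hyp : RegFormula L ctx
  concl : RegFormula L ctx

/-- A regular theory over `L`: an arbitrary set of regular sequents. -/
abbrev RegTheory (L : FirstOrder.Language.{u, v}) : Type (max u v) := Set (Sequent L)

open RegFormula

/-- Derivability of a sequent in context from the theory `T` in regular logic. The logic is free:
contexts are recorded, and domains are not assumed to be inhabited. -/
inductive Derives {L : FirstOrder.Language.{u, v}} (T : RegTheory L) :
    {n : ℕ} → RegFormula L n → RegFormula L n → Prop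
  | ax (σ : Sequent L) (h : σ ∈ T) : Derives T σ.hyp σ.concl
  | refl {n : ℕ} (φ : RegFormula L n) : Derives T φ φ
  | cut {n : ℕ} {φ ψ χ : RegFormula L n} (h₁ : Derives T φ ψ) (h₂ : Derives T ψ χ) :
      Derives T φ χ
  | subst {n m : ℕ} {φ ψ : RegFormula L n} (σ : Fin n → L.Term (Fin m)) (h : Derives T φ ψ) :
      Derives T (φ.subst σ) (ψ.subst σ)
  | eq_refl {n : ℕ} (t : L.Term (Fin n)) : Derives T top (equal t t)
  | eq_subst {n : ℕ} (t s : L.Term (Fin n)) (φ : RegFormula L (n + 1)) :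
      Derives T
        (and (equal t s) (φ.subst (Fin.snoc (α := fun _ => L.Term (Fin n)) Term.var t)))
        (φ.subst (Fin.snoc (α := fun _ => L.Term (Fin n)) Term.var s))
  | top_intro {n : ℕ} (φ : RegFormula L n) : Derives T φ top
  | and_left {n : ℕ} (φ ψ : RegFormula L n) : Derives T (and φ ψ) φ
  | and_right {n : ℕ} (φ ψ : RegFormula L n) : Derives T (and φ ψ) ψ
  | and_intro {n : ℕ} {φ ψ χ : RegFormula L n} (h₁ : Derives T φ ψ) (h₂ : Derives T φ χ) :
      Derives T φ (and ψ χ)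
  | ex_left {n : ℕ} {φ : RegFormula L (n + 1)} {ψ : RegFormula L n}
      (h : Derives T φ (ψ.wk 1)) : Derives T (ex φ) ψ
  | ex_right {n : ℕ} {φ : RegFormula L (n + 1)} {ψ : RegFormula L n}
      (h : Derives T (ex φ) ψ) : Derives T φ (ψ.wk 1)
  | frobenius {n : ℕ} (φ : RegFormula L n) (ψ : RegFormula L (n + 1)) :
      Derives T (and φ (ex ψ)) (ex (and (φ.wk 1) ψ))

/-! ### Substitution calculus -/

section Calculus

variable {L : FirstOrder.Language.{u, v}}

theorem term_subst_subst {α β γ : Type*} (t : L.Term α) (σ : α → L.Term β) (τ : β → L.Term γ) :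
    (t.subst σ).subst τ = t.subst fun i => (σ i).subst τ := by
  induction t with
  | var => rfl
  | func f ts ih => simp [ih]

theorem term_subst_var {α : Type*} (t : L.Term α) : t.subst Term.var = t := by
  induction t with
  | var => rfl
  | func f ts ih => simp [ih]

theorem lift_castSucc {n m : ℕ} (σ : Fin n → L.Term (Fin m)) (i : Fin n) :
    lift σ i.castSucc = (σ i).subst fun j => Term.var j.castSucc := by
  simp [lift]

theorem lift_last {n m : ℕ} (σ : Fin n → L.Term (Fin m)) :
    lift σ (Fin.last n) = Term.var (Fin.last m) := by
  simp [lift]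

theorem lift_comp {n m k : ℕ} (σ : Fin n → L.Term (Fin m)) (τ : Fin m → L.Term (Fin k)) :
    (fun i => (lift σ i).subst (lift τ)) = lift fun i => (σ i).subst τ := by
  funext i
  refine Fin.lastCases ?_ (fun i => ?_) i
  · simp [lift_last]
  · simp [lift_castSucc, term_subst_subst]

theorem lift_var {n : ℕ} : lift (Term.var : Fin n → L.Term (Fin n)) = Term.var := by
  funext i
  refine Fin.lastCases ?_ (fun i => ?_) i
  · simp [lift_last]
  · simp [lift_castSucc]

theorem subst_subst {n m k : ℕ} (φ : RegFormula L n) (σ : Fin n → L.Term (Fin m))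
    (τ : Fin m → L.Term (Fin k)) :
    (φ.subst σ).subst τ = φ.subst fun i => (σ i).subst τ := by
  induction φ generalizing m k with
  | top => rfl
  | equal t s => simp [RegFormula.subst, term_subst_subst]
  | rel R ts => simp [RegFormula.subst, term_subst_subst]
  | and φ ψ ih₁ ih₂ => simp [RegFormula.subst, ih₁, ih₂]
  | ex φ ih => simp [RegFormula.subst, ih, lift_comp]

theorem subst_var {n : ℕ} (φ : RegFormula L n) : φ.subst Term.var = φ := by
  induction φ with
  | top => rfl
  | equal t s => simp [RegFormula.subst, term_subst_var]
  | rel R ts => simp [RegFormula.subst, term_subst_var]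
  | and φ ψ ih₁ ih₂ => simp [RegFormula.subst, ih₁, ih₂]
  | ex φ ih => simp [RegFormula.subst, ih, lift_var]

/-- Weakening of a tuple of terms. -/
def wkT {N n : ℕ} (k : ℕ) (a : Fin n → L.Term (Fin N)) : Fin n → L.Term (Fin (N + k)) :=
  fun i => (a i).subst fun j => Term.var (Fin.castAdd k j)

/-- The tuple of the last `k` variables of a context. -/
def vars (N k : ℕ) : Fin k → L.Term (Fin (N + k)) := fun j => Term.var (Fin.natAdd N j)

/-- The tuple of the first `N` variables of a context. -/
def vars₀ (N k : ℕ) : Fin N → L.Term (Fin (N + k)) := fun j => Term.var (Fin.castAdd k j)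

/-- Substitution of a tuple `a` for the first `n`, and of `b` for the last `m` variables. -/
def subst₂ {n m N : ℕ} (θ : RegFormula L (n + m)) (a : Fin n → L.Term (Fin N))
    (b : Fin m → L.Term (Fin N)) : RegFormula L N :=
  θ.subst (Fin.append a b)

theorem subst₂_subst {n m N K : ℕ} (θ : RegFormula L (n + m)) (a : Fin n → L.Term (Fin N))
    (b : Fin m → L.Term (Fin N)) (σ : Fin N → L.Term (Fin K)) :
    (subst₂ θ a b).subst σ = subst₂ θ (fun i => (a i).subst σ) fun j => (b j).subst σ := by
  unfold subst₂
  rw [subst_subst]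
  congr 1
  funext i
  refine Fin.addCases (fun i => ?_) (fun i => ?_) i <;> simp

theorem subst₂_vars {n m : ℕ} (θ : RegFormula L (n + m)) :
    subst₂ θ (vars₀ n m) (vars n m) = θ := by
  unfold subst₂
  have : Fin.append (vars₀ n m) (vars n m) = (Term.var : Fin (n + m) → L.Term (Fin (n + m))) := by
    funext i
    refine Fin.addCases (fun i => ?_) (fun i => ?_) i <;> simp [vars₀, vars]
  rw [this, subst_var]

theorem wk_subst {n N k : ℕ} (φ : RegFormula L n) (a : Fin n → L.Term (Fin N)) :
    (φ.subst a).wk k = φ.subst (wkT k a) := subst_subst _ _ _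

theorem wk_subst₂ {n m N k : ℕ} (θ : RegFormula L (n + m)) (a : Fin n → L.Term (Fin N))
    (b : Fin m → L.Term (Fin N)) :
    (subst₂ θ a b).wk k = subst₂ θ (wkT k a) (wkT k b) := subst₂_subst _ _ _ _

theorem subst_exs {n m : ℕ} (k : ℕ) (φ : RegFormula L (n + k)) (σ : Fin n → L.Term (Fin m)) :
    (exs k φ).subst σ = exs k (subst₂ φ (wkT k σ) (vars m k)) := by
  induction k with
  | zero =>
    simp only [exs, subst₂]
    congr 1
    funext i
    have h : (fun j : Fin m => (Term.var (Fin.castAdd 0 j) : L.Term (Fin (m + 0)))) = Term.var := rfl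
    have h2 : Fin.append (wkT 0 σ) (vars m 0) (Fin.castAdd 0 i) = wkT 0 σ i := Fin.append_left _ _ _
    refine Eq.trans ?_ h2.symm
    unfold wkT
    rw [h]
    exact (term_subst_var _).symm
  | succ k ih =>
    simp only [exs]
    rw [ih]
    simp only [subst₂, RegFormula.subst]
    congr 3
    funext i
    refine Fin.lastCases ?_ (fun i => ?_) i
    · rw [lift_last]
      exact (Fin.append_right (wkT (k + 1) σ) (vars m (k + 1)) (Fin.last k)).symm
    · rw [lift_castSucc]
      refine Fin.addCases (fun i => ?_) (fun i => ?_) i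
      · rw [Fin.append_left]
        refine Eq.trans ?_ (Fin.append_left (wkT (k + 1) σ) (vars m (k + 1)) i).symm
        exact term_subst_subst _ _ _
      · rw [Fin.append_right]
        exact (Fin.append_right (wkT (k + 1) σ) (vars m (k + 1)) i.castSucc).symm

theorem subst_eqs {n m : ℕ} (k : ℕ) (t s : Fin k → L.Term (Fin n)) (σ : Fin n → L.Term (Fin m)) :
    (eqs k t s).subst σ = eqs k (fun j => (t j).subst σ) fun j => (s j).subst σ := by
  induction k with
  | zero => rfl
  | succ k ih => simp [eqs, RegFormula.subst, ih]

end Calculus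

/-! ### Derived rules -/

namespace Derives

variable {L : FirstOrder.Language.{u, v}} {T : RegTheory L}

theorem and_mono {n : ℕ} {φ φ' ψ ψ' : RegFormula L n} (h₁ : Derives T φ φ')
    (h₂ : Derives T ψ ψ') : Derives T (and φ ψ) (and φ' ψ') :=
  and_intro (cut (and_left _ _) h₁) (cut (and_right _ _) h₂)

theorem weaken {n : ℕ} {φ ψ : RegFormula L n} (k : ℕ) (h : Derives T φ ψ) :
    Derives T (φ.wk k) (ψ.wk k) := subst _ h

theorem exs_iff {n : ℕ} (k : ℕ) {φ : RegFormula L (n + k)} {ψ : RegFormula L n} :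
    Derives T (exs k φ) ψ ↔ Derives T φ (ψ.wk k) := by
  induction k with
  | zero =>
    have : ψ.wk 0 = ψ := subst_var ψ
    rw [this]; rfl
  | succ k ih =>
    have : ψ.wk (k + 1) = (ψ.wk k).wk 1 := by
      unfold wk; rw [subst_subst]; rfl
    rw [this]
    exact ih.trans ⟨ex_right, ex_left⟩

theorem exs_mono {n : ℕ} (k : ℕ) {φ ψ : RegFormula L (n + k)} (h : Derives T φ ψ) :
    Derives T (exs k φ) (exs k ψ) :=
  (exs_iff k).2 (cut h ((exs_iff k).1 (refl _)))

theorem exs_frobenius {n : ℕ} (k : ℕ) (φ : RegFormula L n) (ψ : RegFormula L (n + k)) :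
    Derives T (and φ (exs k ψ)) (exs k (and (φ.wk k) ψ)) := by
  induction k with
  | zero =>
    have : φ.wk 0 = φ := subst_var φ
    rw [this]; exact refl _
  | succ k ih =>
    have : φ.wk (k + 1) = (φ.wk k).wk 1 := by
      unfold wk; rw [subst_subst]; rfl
    rw [this]
    exact cut (ih (ex ψ)) (exs_mono k (frobenius _ _))

theorem exs_elim {n k : ℕ} {γ χ : RegFormula L n} {φ : RegFormula L (n + k)}
    (h : Derives T γ (exs k φ)) (h' : Derives T (and (γ.wk k) φ) (χ.wk k)) : Derives T γ χ :=
  cut (and_intro (refl _) h) (cut (exs_frobenius k γ φ) ((exs_iff k).2 h'))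

theorem exs_intro {n k : ℕ} {γ : RegFormula L n} {φ : RegFormula L (n + k)}
    (t : Fin k → L.Term (Fin n)) (h : Derives T γ (subst₂ φ Term.var t)) :
    Derives T γ (exs k φ) := by
  refine cut h ?_
  have h₁ := subst (Fin.append Term.var t) ((exs_iff (T := T) k).1 (refl (exs k φ)))
  have h₂ : ((exs k φ).wk k).subst (Fin.append Term.var t) = exs k φ := by
    refine (subst_subst _ _ _).trans (Eq.trans ?_ (subst_var _))
    congr 1
    funext i
    simp
  rwa [h₂] at h₁

theorem eq_refl' {n : ℕ} {γ : RegFormula L n} (t : L.Term (Fin n)) : Derives T γ (equal t t) :=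
  cut (top_intro _) (eq_refl t)

theorem replace {n m : ℕ} {γ : RegFormula L n} (φ : RegFormula L m) {σ τ : Fin m → L.Term (Fin n)}
    (h : ∀ i, Derives T γ (equal (σ i) (τ i))) (hφ : Derives T γ (φ.subst σ)) :
    Derives T γ (φ.subst τ) := by
  classical
  have key : ∀ s : Finset (Fin m),
      Derives T γ (φ.subst fun k => if k ∈ s then τ k else σ k) := by
    intro s
    induction s using Finset.induction_on with
    | empty => simpa using hφ
    | insert i s hi ih =>
      let ρ : Fin m → L.Term (Fin (n + 1)) := fun k =>
        if k = i then Term.var (Fin.last n)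
        else (if k ∈ s then τ k else σ k).subst fun j => Term.var j.castSucc
      have e : ∀ t : L.Term (Fin n),
          (φ.subst ρ).subst (Fin.snoc (α := fun _ => L.Term (Fin n)) Term.var t) =
            φ.subst fun k => if k = i then t else if k ∈ s then τ k else σ k := by
        intro t
        rw [subst_subst]
        congr 1
        funext k
        by_cases hk : k = i
        · simp [ρ, hk]
        · simp only [ρ, hk, if_false]
          rw [term_subst_subst]
          simp [term_subst_var]
      have h₁ := eq_subst (T := T) (σ i) (τ i) (φ.subst ρ)
      rw [e, e] at h₁
      have e₁ : (fun k => if k = i then σ i else if k ∈ s then τ k else σ k) =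
          fun k => if k ∈ s then τ k else σ k := by
        funext k
        by_cases hk : k = i
        · subst hk; simp [hi]
        · simp [hk]
      have e₂ : (fun k => if k = i then τ i else if k ∈ s then τ k else σ k) =
          fun k => if k ∈ insert i s then τ k else σ k := by
        funext k
        by_cases hk : k = i
        · subst hk; simp
        · simp [hk]
      rw [e₁, e₂] at h₁
      exact cut (and_intro (h i) ih) h₁
  simpa using key Finset.univ

theorem eq_symm {n : ℕ} {γ : RegFormula L n} {t s : L.Term (Fin n)}
    (h : Derives T γ (equal t s)) : Derives T γ (equal s t) := by
  have := replace (T := T) (γ := γ) (equal (Term.var (0 : Fin 2)) (Term.var 1))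
    (σ := ![t, t]) (τ := ![s, t])
    (fun i => by fin_cases i; exacts [h, eq_refl' _]) (eq_refl' _)
  exact this

theorem eqs_iff {n : ℕ} {γ : RegFormula L n} (k : ℕ) {t s : Fin k → L.Term (Fin n)} :
    Derives T γ (eqs k t s) ↔ ∀ j, Derives T γ (equal (t j) (s j)) := by
  induction k with
  | zero => exact ⟨fun _ j => j.elim0, fun _ => top_intro _⟩
  | succ k ih =>
    constructor
    · intro h j
      refine Fin.lastCases ?_ (fun j => ?_) j
      · exact cut h (and_right _ _)
      · exact ih.1 (cut h (and_left _ _)) j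
    · intro h
      exact and_intro (ih.2 fun j => h _) (h _)

theorem replace₂ {n m N : ℕ} {γ : RegFormula L N} {θ : RegFormula L (n + m)}
    {a a' : Fin n → L.Term (Fin N)} {b b' : Fin m → L.Term (Fin N)}
    (ha : ∀ i, Derives T γ (equal (a i) (a' i))) (hb : ∀ j, Derives T γ (equal (b j) (b' j)))
    (h : Derives T γ (subst₂ θ a b)) : Derives T γ (subst₂ θ a' b') := by
  refine replace θ (fun i => ?_) h
  refine Fin.addCases (fun i => ?_) (fun i => ?_) i <;> simp [ha, hb]

end Derives

/-! ### The syntactic category -/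

section SynCat

variable {L : FirstOrder.Language.{u, v}}

/-- Objects of the syntactic category: regular formulas in context. -/
structure SynCat (T : RegTheory L) where
  ctx : ℕ
  formula : RegFormula L ctx

variable {T : RegTheory L}

/-- `θ(x, y)` is `T`-provably a functional relation from `{x. φ}` to `{y. ψ}`. -/
structure IsFunctional (T : RegTheory L) {n m : ℕ} (φ : RegFormula L n) (ψ : RegFormula L m)
    (θ : RegFormula L (n + m)) : Prop where
  dom : Derives T θ (φ.subst (vars₀ n m))
  cod : Derives T θ (ψ.subst (vars n m))
  total : Derives T φ (exs m θ)
  unique : Derives T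
    (and (subst₂ θ (wkT m (vars₀ n m)) (wkT m (vars n m)))
      (subst₂ θ (wkT m (vars₀ n m)) (vars (n + m) m)))
    (eqs m (wkT m (vars n m)) (vars (n + m) m))

namespace IsFunctional

variable {n m N : ℕ} {φ : RegFormula L n} {ψ : RegFormula L m} {θ : RegFormula L (n + m)}
  {γ : RegFormula L N} {a : Fin n → L.Term (Fin N)} {b b' : Fin m → L.Term (Fin N)}

theorem inst {n m N : ℕ} {θ : RegFormula L (n + m)} {ψ : RegFormula L (n + m)}
    {γ : RegFormula L N} {a : Fin n → L.Term (Fin N)} {b : Fin m → L.Term (Fin N)}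
    (h : Derives T θ ψ) (h' : Derives T γ (subst₂ θ a b)) : Derives T γ (subst₂ ψ a b) :=
  Derives.cut h' (Derives.subst _ h)

theorem dom' (h : IsFunctional T φ ψ θ) (h' : Derives T γ (subst₂ θ a b)) :
    Derives T γ (φ.subst a) := by
  have := inst h.dom h'
  have e : subst₂ (φ.subst (vars₀ n m)) a b = φ.subst a := by
    unfold subst₂; rw [subst_subst]; simp [vars₀]
  rwa [e] at this

theorem cod' (h : IsFunctional T φ ψ θ) (h' : Derives T γ (subst₂ θ a b)) :
    Derives T γ (ψ.subst b) := by
  have := inst h.cod h'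
  have e : subst₂ (ψ.subst (vars n m)) a b = ψ.subst b := by
    unfold subst₂; rw [subst_subst]; simp [vars]
  rwa [e] at this

theorem total' (h : IsFunctional T φ ψ θ) (h' : Derives T γ (φ.subst a)) :
    Derives T γ (exs m (subst₂ θ (wkT m a) (vars N m))) := by
  have := Derives.cut h' (Derives.subst a h.total)
  rwa [subst_exs] at this

theorem unique' (h : IsFunctional T φ ψ θ) (h₁ : Derives T γ (subst₂ θ a b))
    (h₂ : Derives T γ (subst₂ θ a b')) (j : Fin m) : Derives T γ (equal (b j) (b' j)) := by
  have h₃ := Derives.subst (Fin.append (Fin.append a b) b') h.unique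
  simp only [RegFormula.subst, subst₂_subst, subst_eqs] at h₃
  have e₁ : (fun i => (wkT m (vars₀ n m) i).subst (Fin.append (Fin.append a b) b')) = a := by
    funext i; simp [wkT, vars₀]
  have e₂ : (fun i => (wkT m (vars n m) i).subst (Fin.append (Fin.append a b) b')) = b := by
    funext i; simp [wkT, vars]
  have e₃ : (fun i => (vars (n + m) m i).subst (Fin.append (Fin.append a b) b')) = b' := by
    funext i; simp [vars]
  rw [e₁, e₂, e₃] at h₃
  exact (Derives.eqs_iff m).1 (Derives.cut (Derives.and_intro h₁ h₂) h₃) j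

/-- The rule for using the totality of a functional relation. -/
theorem elim {χ : RegFormula L N} (h : IsFunctional T φ ψ θ) (h' : Derives T γ (φ.subst a))
    (hχ : Derives T (and (γ.wk m) (subst₂ θ (wkT m a) (vars N m))) (χ.wk m)) : Derives T γ χ :=
  Derives.exs_elim (h.total' h') hχ

/-- A provable implication between functional relations is an equivalence. -/
theorem converse {θ' : RegFormula L (n + m)} (h : IsFunctional T φ ψ θ)
    (h' : IsFunctional T φ ψ θ') (le : Derives T θ θ') : Derives T θ' θ := by
  have h₀ : Derives T θ' (subst₂ θ' (vars₀ n m) (vars n m)) := by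
    rw [subst₂_vars]; exact Derives.refl _
  refine h.elim (h'.dom' h₀) ?_
  have hθ := Derives.and_right (T := T) (θ'.wk m)
    (subst₂ θ (wkT m (vars₀ n m)) (vars (n + m) m))
  have hθ' : Derives T (and (θ'.wk m) (subst₂ θ (wkT m (vars₀ n m)) (vars (n + m) m)))
      (subst₂ θ' (wkT m (vars₀ n m)) (wkT m (vars n m))) := by
    rw [← wk_subst₂, subst₂_vars]; exact Derives.and_left _ _
  have hu := h'.unique' (inst le hθ) hθ'
  have := Derives.replace₂ (fun i => Derives.eq_refl' _) hu hθ
  rwa [← wk_subst₂, subst₂_vars] at this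

end IsFunctional

/-- The identity relation on `{x. φ}`: the formula `φ(x) ∧ x = x'`. -/
def idRel {n : ℕ} (φ : RegFormula L n) : RegFormula L (n + n) :=
  and (φ.subst (vars₀ n n)) (eqs n (vars₀ n n) (vars n n))

/-- The relational composite `∃ z, θ(x, z) ∧ χ(z, y)`. -/
def compRel {n m k : ℕ} (θ : RegFormula L (n + m)) (χ : RegFormula L (m + k)) :
    RegFormula L (n + k) :=
  exs m (and (subst₂ θ (wkT m (vars₀ n k)) (vars (n + k) m))
    (subst₂ χ (vars (n + k) m) (wkT m (vars n k))))

theorem idRel_iff {n N : ℕ} {φ : RegFormula L n} {γ : RegFormula L N}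
    {a b : Fin n → L.Term (Fin N)} :
    Derives T γ (subst₂ (idRel φ) a b) ↔
      Derives T γ (φ.subst a) ∧ ∀ i, Derives T γ (equal (a i) (b i)) := by
  have e : subst₂ (idRel φ) a b = and (φ.subst a) (eqs n a b) := by
    unfold subst₂ idRel
    simp only [RegFormula.subst, subst_subst, subst_eqs]
    simp [vars₀, vars, -Fin.natAdd_eq_addNat]
  rw [e, ← Derives.eqs_iff]
  exact ⟨fun h => ⟨h.cut (Derives.and_left _ _), h.cut (Derives.and_right _ _)⟩,
    fun h => Derives.and_intro h.1 h.2⟩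

section Comp

variable {n m k N : ℕ} {θ : RegFormula L (n + m)} {χ : RegFormula L (m + k)}
  {γ : RegFormula L N} {a : Fin n → L.Term (Fin N)} {b : Fin k → L.Term (Fin N)}

theorem wkT_append_left (p : ℕ) (a : Fin n → L.Term (Fin N)) (b : Fin k → L.Term (Fin N)) :
    (fun i => (wkT p (vars₀ n k) i).subst (Fin.append (wkT p (Fin.append a b)) (vars N p))) =
      wkT p a := by
  funext i; simp [wkT, vars₀]

theorem wkT_append_right (p : ℕ) (a : Fin n → L.Term (Fin N)) (b : Fin k → L.Term (Fin N)) :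
    (fun i => (wkT p (vars n k) i).subst (Fin.append (wkT p (Fin.append a b)) (vars N p))) =
      wkT p b := by
  funext i; simp [wkT, vars]

theorem compRel_subst₂ : subst₂ (compRel θ χ) a b =
    exs m (and (subst₂ θ (wkT m a) (vars N m)) (subst₂ χ (vars N m) (wkT m b))) := by
  have e : (fun i => (vars (n + k) m i).subst
      (Fin.append (wkT m (Fin.append a b)) (vars N m))) = vars N m := by
    funext i; simp [vars]
  conv_lhs => unfold subst₂ compRel
  rw [subst_exs]
  conv_lhs => unfold subst₂
  simp only [RegFormula.subst]
  have e₁ := subst₂_subst θ (wkT m (vars₀ n k)) (vars (n + k) m)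
    (Fin.append (wkT m (Fin.append a b)) (vars N m))
  have e₂ := subst₂_subst χ (vars (n + k) m) (wkT m (vars n k))
    (Fin.append (wkT m (Fin.append a b)) (vars N m))
  rw [wkT_append_left, e] at e₁
  rw [wkT_append_right, e] at e₂
  rw [← e₁, ← e₂]
  rfl

theorem compRel_intro (c : Fin m → L.Term (Fin N)) (h₁ : Derives T γ (subst₂ θ a c))
    (h₂ : Derives T γ (subst₂ χ c b)) : Derives T γ (subst₂ (compRel θ χ) a b) := by
  rw [compRel_subst₂]
  refine Derives.exs_intro c ?_
  have w : ∀ {p : ℕ} (t : Fin p → L.Term (Fin N)),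
      (fun i => (wkT m t i).subst (Fin.append Term.var c)) = t := by
    intro p t
    funext i
    refine (term_subst_subst _ _ _).trans (Eq.trans ?_ (term_subst_var _))
    congr 1
    funext j
    simp
  have w' : (fun i => (vars N m i).subst (Fin.append Term.var c)) = c := by
    funext i; simp [vars]
  have e₁ := subst₂_subst θ (wkT m a) (vars N m) (Fin.append Term.var c)
  have e₂ := subst₂_subst χ (vars N m) (wkT m b) (Fin.append Term.var c)
  rw [w, w'] at e₁ e₂
  have := Derives.and_intro h₁ h₂
  rw [← e₁, ← e₂] at this
  exact this

theorem compRel_elim {δ : RegFormula L N} (h : Derives T γ (subst₂ (compRel θ χ) a b))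
    (h' : ∀ γ' : RegFormula L (N + m), Derives T γ' (γ.wk m) →
      Derives T γ' (subst₂ θ (wkT m a) (vars N m)) →
      Derives T γ' (subst₂ χ (vars N m) (wkT m b)) → Derives T γ' (δ.wk m)) :
    Derives T γ δ := by
  rw [compRel_subst₂] at h
  exact Derives.exs_elim h (h' _ (Derives.and_left _ _)
    ((Derives.and_right _ _).cut (Derives.and_left _ _))
    ((Derives.and_right _ _).cut (Derives.and_right _ _)))

end Comp

theorem derives_self {n m : ℕ} (θ : RegFormula L (n + m)) :
    Derives T θ (subst₂ θ (vars₀ n m) (vars n m)) := by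
  rw [subst₂_vars]; exact Derives.refl _

theorem isFunctional_id {n : ℕ} (φ : RegFormula L n) : IsFunctional T φ φ (idRel φ) where
  dom := (idRel_iff.1 (derives_self _)).1
  cod := Derives.replace φ (idRel_iff.1 (derives_self _)).2 (idRel_iff.1 (derives_self _)).1
  total := by
    refine Derives.exs_intro Term.var (idRel_iff.2 ⟨?_, fun i => Derives.eq_refl' _⟩)
    rw [subst_var]; exact Derives.refl _
  unique := by
    refine (Derives.eqs_iff n).2 fun j => ?_
    have h₁ := (idRel_iff.1 (Derives.and_left (T := T)
      (subst₂ (idRel φ) (wkT n (vars₀ n n)) (wkT n (vars n n)))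
      (subst₂ (idRel φ) (wkT n (vars₀ n n)) (vars (n + n) n)))).2 j
    have h₂ := (idRel_iff.1 (Derives.and_right (T := T)
      (subst₂ (idRel φ) (wkT n (vars₀ n n)) (wkT n (vars n n)))
      (subst₂ (idRel φ) (wkT n (vars₀ n n)) (vars (n + n) n)))).2 j
    have := Derives.replace (equal (Term.var (0 : Fin 2)) (Term.var 1))
      (σ := ![wkT n (vars₀ n n) j, vars (n + n) n j]) (τ := ![wkT n (vars n n) j, vars (n + n) n j])
      (fun i => by fin_cases i; exacts [h₁, Derives.eq_refl' _]) h₂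
    exact this

theorem isFunctional_comp {n m k : ℕ} {φ : RegFormula L n} {ψ : RegFormula L m}
    {ξ : RegFormula L k} {θ : RegFormula L (n + m)} {χ : RegFormula L (m + k)}
    (hθ : IsFunctional T φ ψ θ) (hχ : IsFunctional T ψ ξ χ) :
    IsFunctional T φ ξ (compRel θ χ) where
  dom := by
    refine compRel_elim (derives_self (compRel θ χ)) fun γ' _ h₁ _ => ?_
    rw [wk_subst]; exact hθ.dom' h₁
  cod := by
    refine compRel_elim (derives_self (compRel θ χ)) fun γ' _ _ h₂ => ?_
    rw [wk_subst]; exact hχ.cod' h₂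
  total := by
    have h₀ : Derives T φ (φ.subst Term.var) := by rw [subst_var]; exact Derives.refl _
    refine hθ.elim h₀ ?_
    have h₁ := Derives.and_right (T := T) (φ.wk m) (subst₂ θ (wkT m Term.var) (vars n m))
    refine hχ.elim (hθ.cod' h₁) ?_
    have h₂ := Derives.and_right (T := T)
      ((and (φ.wk m) (subst₂ θ (wkT m Term.var) (vars n m))).wk k)
      (subst₂ χ (wkT k (vars n m)) (vars (n + m) k))
    have h₃ := Derives.cut (Derives.and_left (T := T)
      ((and (φ.wk m) (subst₂ θ (wkT m Term.var) (vars n m))).wk k)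
      (subst₂ χ (wkT k (vars n m)) (vars (n + m) k))) (Derives.weaken k h₁)
    rw [wk_subst₂] at h₃
    have h₄ := compRel_intro _ h₃ h₂
    have e : ((exs k (compRel θ χ)).wk m).wk k =
        exs k (subst₂ (compRel θ χ) (wkT k (wkT k (wkT m Term.var))) (vars (n + m + k) k)) := by
      have h : ((exs k (compRel θ χ)).wk m).wk k =
          (exs k (compRel θ χ)).subst (wkT k (wkT m Term.var)) := by
        unfold wk
        rw [subst_subst]
        rfl
      rw [h, subst_exs]
    rw [e]
    refine Derives.exs_intro (vars (n + m) k) ?_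
    have e' : subst₂ (subst₂ (compRel θ χ) (wkT k (wkT k (wkT m Term.var))) (vars (n + m + k) k))
        Term.var (vars (n + m) k) =
        subst₂ (compRel θ χ) (wkT k (wkT m Term.var)) (vars (n + m) k) := by
      conv_lhs => unfold subst₂
      have := subst₂_subst (compRel θ χ) (wkT k (wkT k (wkT m Term.var))) (vars (n + m + k) k)
        (Fin.append Term.var (vars (n + m) k))
      refine this.trans ?_
      congr 1
      · funext i; simp [wkT]
      · funext i; simp [vars]
    rw [e']
    exact h₄
  unique := by
    refine compRel_elim (Derives.and_left (T := T)
      (subst₂ (compRel θ χ) (wkT k (vars₀ n k)) (wkT k (vars n k)))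
      (subst₂ (compRel θ χ) (wkT k (vars₀ n k)) (vars (n + k) k))) fun γ' h₀ h₁ h₂ => ?_
    have h₃ := Derives.cut h₀ (Derives.weaken m (Derives.and_right (T := T) _ _))
    rw [wk_subst₂] at h₃
    refine compRel_elim h₃ fun γ'' g₀ g₁ g₂ => ?_
    have h₁' := Derives.cut g₀ (Derives.weaken m h₁)
    have h₂' := Derives.cut g₀ (Derives.weaken m h₂)
    rw [wk_subst₂] at h₁' h₂'
    have hu := hθ.unique' h₁' g₁
    have hv := hχ.unique' (Derives.replace₂ hu (fun j => Derives.eq_refl' _) h₂') g₂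
    have e : ((eqs k (wkT k (vars n k)) (vars (n + k) k)).wk m).wk m =
        eqs k (wkT m (wkT m (wkT k (vars n k)))) (wkT m (wkT m (vars (n + k) k) :
          Fin k → L.Term (Fin (n + k + k + m)))) := by
      unfold wk
      rw [subst_eqs, subst_eqs]
      rfl
    rw [e]
    exact (Derives.eqs_iff k).2 hv

theorem compRel_mono {n m k : ℕ} {θ θ' : RegFormula L (n + m)} {χ χ' : RegFormula L (m + k)}
    (h : Derives T θ θ') (h' : Derives T χ χ') : Derives T (compRel θ χ) (compRel θ' χ') :=
  Derives.exs_mono m (Derives.and_mono (Derives.subst _ h) (Derives.subst _ h'))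

theorem derives_of_self {n m : ℕ} {θ θ' : RegFormula L (n + m)}
    (h : Derives T θ (subst₂ θ' (vars₀ n m) (vars n m))) : Derives T θ θ' := by
  rwa [subst₂_vars] at h

/-- Functional relations from `A` to `B` modulo `T`-provable equivalence. -/
def homSetoid (A B : SynCat T) :
    Setoid {θ : RegFormula L (A.ctx + B.ctx) // IsFunctional T A.formula B.formula θ} where
  r θ θ' := Derives T θ.1 θ'.1 ∧ Derives T θ'.1 θ.1
  iseqv := ⟨fun _ => ⟨Derives.refl _, Derives.refl _⟩, fun h => ⟨h.2, h.1⟩,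
    fun h h' => ⟨h.1.cut h'.1, h'.2.cut h.2⟩⟩

/-- Morphisms of the syntactic category. -/
def SynHom (A B : SynCat T) : Type (max u v) := Quotient (homSetoid A B)

/-- The morphism given by a `T`-provably functional relation. -/
def SynHom.mk {A B : SynCat T} (θ : RegFormula L (A.ctx + B.ctx))
    (h : IsFunctional T A.formula B.formula θ) : SynHom A B :=
  Quotient.mk (homSetoid A B) ⟨θ, h⟩

theorem SynHom.sound {A B : SynCat T} {θ θ' : RegFormula L (A.ctx + B.ctx)}
    (h : IsFunctional T A.formula B.formula θ) (h' : IsFunctional T A.formula B.formula θ')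
    (le : Derives T θ θ') : SynHom.mk θ h = SynHom.mk θ' h' :=
  Quotient.sound (s := homSetoid A B) ⟨le, h.converse h' le⟩

/-- Composition in the syntactic category. -/
def SynHom.comp {A B C : SynCat T} (f : SynHom A B) (g : SynHom B C) : SynHom A C :=
  Quotient.liftOn₂ f g
    (fun θ χ => SynHom.mk (compRel θ.1 χ.1) (isFunctional_comp θ.2 χ.2))
    fun _ _ _ _ h h' => SynHom.sound _ _ (compRel_mono h.1 h'.1)

/-- The (regular) syntactic category of the regular theory `T`. -/
instance (T : RegTheory L) : Category (SynCat T) where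
  Hom := SynHom
  id A := SynHom.mk (idRel A.formula) (isFunctional_id _)
  comp := SynHom.comp
  id_comp := by
    rintro A B ⟨θ, h⟩
    refine SynHom.sound (isFunctional_comp (isFunctional_id _) h) h (derives_of_self ?_)
    refine compRel_elim (derives_self _) fun γ' _ h₁ h₂ => ?_
    rw [wk_subst₂]
    exact Derives.replace₂ (fun i => ((idRel_iff.1 h₁).2 i).eq_symm)
      (fun j => Derives.eq_refl' _) h₂
  comp_id := by
    rintro A B ⟨θ, h⟩
    refine SynHom.sound (isFunctional_comp h (isFunctional_id _)) h (derives_of_self ?_)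
    refine compRel_elim (derives_self _) fun γ' _ h₁ h₂ => ?_
    rw [wk_subst₂]
    exact Derives.replace₂ (fun i => Derives.eq_refl' _) (idRel_iff.1 h₂).2 h₁
  assoc := by
    rintro A B C D ⟨θ, hθ⟩ ⟨χ, hχ⟩ ⟨ω, hω⟩
    refine SynHom.sound (isFunctional_comp (isFunctional_comp hθ hχ) hω)
      (isFunctional_comp hθ (isFunctional_comp hχ hω)) (derives_of_self ?_)
    refine compRel_elim (derives_self _) fun γ' _ h₁ h₂ => ?_
    refine compRel_elim h₁ fun γ'' g₀ g₁ g₂ => ?_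
    have h₂' := Derives.cut g₀ (Derives.weaken _ h₂)
    rw [wk_subst₂] at h₂'
    rw [wk_subst₂, wk_subst₂]
    exact compRel_intro _ g₁ (compRel_intro _ g₂ h₂')

end SynCat

/-! ### Models -/

section Models

variable {L : FirstOrder.Language.{u, v}}

/-- Truth of a sequent in a structure. -/
def Sequent.IsTrueIn (σ : Sequent L) (M : Type w) [L.Structure M] : Prop :=
  ∀ x : Fin σ.ctx → M, σ.hyp.Realize x → σ.concl.Realize x

/-- Tarski models of `T`, with equality interpreted as identity; the domain may be empty. -/
structure Mod (T : RegTheory L) where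
  carrier : Type w
  [str : L.Structure carrier]
  isModel : ∀ σ ∈ T, σ.IsTrueIn carrier

attribute [instance] Mod.str

/-- The category of models of `T` and homomorphisms of structures. -/
instance (T : RegTheory L) : Category (Mod.{u, v, w} T) where
  Hom M N := M.carrier →[L] N.carrier
  id M := Hom.id L M.carrier
  comp f g := g.comp f

/-- The homomorphism of structures underlying a morphism of models. -/
def Mod.hom {T : RegTheory L} {M N : Mod.{u, v, w} T} (g : M ⟶ N) : M.carrier →[L] N.carrier := g

theorem realize_subst {M : Type w} [L.Structure M] {n m : ℕ} (φ : RegFormula L n)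
    (σ : Fin n → L.Term (Fin m)) (x : Fin m → M) :
    (φ.subst σ).Realize x ↔ φ.Realize fun i => (σ i).realize x := by
  induction φ generalizing m with
  | top => rfl
  | equal t s => simp [RegFormula.subst, Realize]
  | rel R ts => simp [RegFormula.subst, Realize]
  | and φ ψ ih₁ ih₂ => simp [RegFormula.subst, Realize, ih₁, ih₂]
  | ex φ ih =>
    simp only [RegFormula.subst, Realize, ih]
    refine exists_congr fun a => ?_
    have : (fun i => (lift σ i).realize (Fin.snoc (α := fun _ => M) x a)) =
        Fin.snoc (α := fun _ => M) (fun i => (σ i).realize x) a := by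
      funext i
      refine Fin.lastCases ?_ (fun i => ?_) i
      · simp [lift_last]
      · simp [lift_castSucc]
    rw [this]

theorem realize_wk {M : Type w} [L.Structure M] {n k : ℕ} (φ : RegFormula L n)
    (x : Fin (n + k) → M) : (φ.wk k).Realize x ↔ φ.Realize fun i => x (Fin.castAdd k i) :=
  realize_subst _ _ _

theorem realize_exs {M : Type w} [L.Structure M] {n : ℕ} (k : ℕ) (φ : RegFormula L (n + k))
    (x : Fin n → M) : (exs k φ).Realize x ↔ ∃ y : Fin k → M, φ.Realize (Fin.append x y) := by
  induction k with
  | zero =>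
    have h : ∀ y : Fin 0 → M, Fin.append x y = x := fun y => by
      funext i; exact Fin.append_left x y i
    exact ⟨fun hx => ⟨Fin.elim0, by rw [h]; exact hx⟩, fun ⟨y, hy⟩ => by rwa [h] at hy⟩
  | succ k ih =>
    refine (ih _).trans ⟨?_, ?_⟩
    · rintro ⟨y, a, h⟩
      refine ⟨Fin.snoc (α := fun _ => M) y a, ?_⟩
      rwa [Fin.append_snoc]
    · rintro ⟨y, h⟩
      refine ⟨Fin.init y, y (Fin.last k), ?_⟩
      rw [← Fin.append_snoc]
      simpa using h

theorem realize_eqs {M : Type w} [L.Structure M] {n : ℕ} (k : ℕ) (t s : Fin k → L.Term (Fin n))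
    (x : Fin n → M) : (eqs k t s).Realize x ↔ ∀ j, (t j).realize x = (s j).realize x := by
  induction k with
  | zero => exact ⟨fun _ j => j.elim0, fun _ => trivial⟩
  | succ k ih =>
    simp only [eqs, Realize, ih]
    exact ⟨fun h j => Fin.lastCases h.2 h.1 j, fun h => ⟨fun j => h _, h _⟩⟩

theorem realize_subst₂ {M : Type w} [L.Structure M] {n m N : ℕ} (θ : RegFormula L (n + m))
    (a : Fin n → L.Term (Fin N)) (b : Fin m → L.Term (Fin N)) (x : Fin N → M) :
    (subst₂ θ a b).Realize x ↔
      θ.Realize (Fin.append (fun i => (a i).realize x) fun j => (b j).realize x) := by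
  unfold subst₂
  rw [realize_subst]
  have : (fun i => (Fin.append a b i).realize x) =
      Fin.append (fun i => (a i).realize x) fun j => (b j).realize x := by
    funext i
    refine Fin.addCases (fun i => ?_) (fun i => ?_) i <;> simp
  rw [this]

theorem realize_compRel {M : Type w} [L.Structure M] {n m k : ℕ} (θ : RegFormula L (n + m))
    (χ : RegFormula L (m + k)) (x : Fin n → M) (y : Fin k → M) :
    (compRel θ χ).Realize (Fin.append x y) ↔
      ∃ z : Fin m → M, θ.Realize (Fin.append x z) ∧ χ.Realize (Fin.append z y) := by
  unfold compRel
  rw [realize_exs]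
  refine exists_congr fun z => ?_
  simp only [Realize, realize_subst₂]
  simp [wkT, vars, vars₀]

theorem realize_idRel {M : Type w} [L.Structure M] {n : ℕ} (φ : RegFormula L n)
    (x y : Fin n → M) :
    (idRel φ).Realize (Fin.append x y) ↔ φ.Realize x ∧ x = y := by
  simp only [idRel, Realize, realize_subst, realize_eqs]
  simp [vars, vars₀, funext_iff, -Fin.natAdd_eq_addNat]

/-- Soundness of the deduction rules. -/
theorem Derives.sound {T : RegTheory L} {n : ℕ} {φ ψ : RegFormula L n} (h : Derives T φ ψ)
    (M : Mod.{u, v, w} T) (x : Fin n → M.carrier) : φ.Realize x → ψ.Realize x := by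
  induction h with
  | ax σ h => exact M.isModel σ h x
  | refl φ => exact id
  | cut _ _ ih₁ ih₂ => exact fun h => ih₂ x (ih₁ x h)
  | subst σ _ ih => rw [realize_subst, realize_subst]; exact ih _
  | eq_refl t => exact fun _ => rfl
  | eq_subst t s φ =>
    rintro ⟨h₁, h₂⟩
    rw [realize_subst] at h₂ ⊢
    convert! h₂ using 2 with i
    refine Fin.lastCases ?_ (fun i => ?_) i
    · simpa using h₁.symm
    · simp
  | top_intro => exact fun _ => trivial
  | and_left => exact And.left
  | and_right => exact And.right
  | and_intro _ _ ih₁ ih₂ => exact fun h => ⟨ih₁ x h, ih₂ x h⟩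
  | ex_left _ ih =>
    rintro ⟨a, ha⟩
    have := (realize_wk _ _).1 (ih _ ha)
    convert! this using 1
    funext i
    exact (Fin.snoc_castSucc (α := fun _ => M.carrier) a x i).symm
  | ex_right _ ih =>
    intro h
    rw [realize_wk]
    refine ih _ ⟨x (Fin.last _), ?_⟩
    convert! h using 1
    exact Fin.snoc_init_self x
  | frobenius φ ψ =>
    rintro ⟨h, a, ha⟩
    refine ⟨a, (realize_wk _ _).2 ?_, ha⟩
    convert! h using 1
    funext i
    exact Fin.snoc_castSucc (α := fun _ => M.carrier) a x i

/-- Homomorphisms preserve regular formulas. -/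
theorem realize_hom {M : Type w} {N : Type w} [L.Structure M] [L.Structure N] (g : M →[L] N)
    {n : ℕ} (φ : RegFormula L n) (x : Fin n → M) (h : φ.Realize x) :
    φ.Realize fun i => g (x i) := by
  have ht : ∀ {n : ℕ} (t : L.Term (Fin n)) (x : Fin n → M),
      t.realize (fun i => g (x i)) = g (t.realize x) := fun t x => HomClass.realize_term g
  induction φ with
  | top => trivial
  | equal t s => exact (ht t x).trans ((congrArg g h).trans (ht s x).symm)
  | rel R ts =>
    have := g.map_rel R _ h
    simp only [Realize, ht]
    exact this
  | and φ ψ ih₁ ih₂ => exact ⟨ih₁ x h.1, ih₂ x h.2⟩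
  | ex φ ih =>
    obtain ⟨a, ha⟩ := h
    refine ⟨g a, ?_⟩
    convert! ih _ ha using 1
    funext i
    refine Fin.lastCases ?_ (fun i => ?_) i <;> simp

end Models

/-! ### The evaluation functor -/

section Evaluation

variable {L : FirstOrder.Language.{u, v}} {T : RegTheory L}

/-- The extension of a formula in context in a model. -/
def Extension (A : SynCat T) (M : Mod.{u, v, w} T) : Type w :=
  {x : Fin A.ctx → M.carrier // A.formula.Realize x}

/-- The action of a homomorphism on extensions. -/
def Extension.map {A : SynCat T} {M N : Mod.{u, v, w} T} (g : M ⟶ N) (x : Extension A M) :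
    Extension A N :=
  ⟨fun i => Mod.hom g (x.1 i), realize_hom (Mod.hom g) _ _ x.2⟩

/-- The extension of a formula in context as a functor of the model. -/
def evObj (A : SynCat T) : Mod.{u, v, w} T ⥤ Type w where
  obj M := Extension A M
  map g := TypeCat.ofHom (Extension.map g)
  map_id _ := rfl
  map_comp _ _ := rfl

/-- The graph of the function that a morphism of the syntactic category defines in a model. -/
def SynHom.Graph {A B : SynCat T} (f : SynHom A B) (M : Mod.{u, v, w} T)
    (x : Fin A.ctx → M.carrier) (y : Fin B.ctx → M.carrier) : Prop :=
  Quotient.liftOn f (fun θ => θ.1.Realize (Fin.append x y))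
    fun _ _ h => propext ⟨h.1.sound M _, h.2.sound M _⟩

theorem SynHom.graph_existsUnique {A B : SynCat T} (f : SynHom A B) (M : Mod.{u, v, w} T)
    (x : Extension A M) : ∃! y : Extension B M, f.Graph M x.1 y.1 := by
  induction f using Quotient.inductionOn with | _ θ
  obtain ⟨θ, h⟩ := θ
  obtain ⟨y, hy⟩ := (realize_exs _ _ _).1 (h.total.sound M x.1 x.2)
  have hc := h.cod.sound M _ hy
  rw [realize_subst] at hc
  simp only [vars, Term.realize_var, Fin.append_right] at hc
  refine ⟨⟨y, hc⟩, hy, ?_⟩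
  rintro ⟨y', hc'⟩ hy'
  have := h.unique.sound M (Fin.append (Fin.append x.1 y) y') (by
    simp only [Realize, realize_subst₂]
    simp only [wkT, vars, vars₀, Term.subst, Term.realize_var, Fin.append_left, Fin.append_right]
    exact ⟨hy, hy'⟩)
  rw [realize_eqs] at this
  simp only [wkT, vars, Term.subst, Term.realize_var, Fin.append_left, Fin.append_right] at this
  exact Subtype.ext (funext fun j => (this j).symm)

/-- The function defined by a morphism of the syntactic category in a model. -/
noncomputable def SynHom.eval {A B : SynCat T} (f : SynHom A B) (M : Mod.{u, v, w} T)
    (x : Extension A M) : Extension B M :=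
  (f.graph_existsUnique M x).choose

theorem SynHom.graph_eval {A B : SynCat T} (f : SynHom A B) (M : Mod.{u, v, w} T)
    (x : Extension A M) : f.Graph M x.1 (f.eval M x).1 :=
  (f.graph_existsUnique M x).choose_spec.1

theorem SynHom.eval_eq {A B : SynCat T} (f : SynHom A B) (M : Mod.{u, v, w} T)
    (x : Extension A M) (y : Extension B M) (h : f.Graph M x.1 y.1) : f.eval M x = y :=
  (f.graph_existsUnique M x).unique (f.graph_eval M x) h

theorem SynHom.graph_hom {A B : SynCat T} (f : SynHom A B) {M N : Mod.{u, v, w} T}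
    (g : M ⟶ N) (x : Extension A M) (y : Extension B M) (h : f.Graph M x.1 y.1) :
    f.Graph N (x.map g).1 (y.map g).1 := by
  induction f using Quotient.inductionOn with | _ θ
  have h₁ : θ.1.Realize fun i => Mod.hom g (Fin.append x.1 y.1 i) :=
    realize_hom (Mod.hom g) θ.1 _ h
  have e : (fun i => Mod.hom g (Fin.append x.1 y.1 i)) = Fin.append (x.map g).1 (y.map g).1 := by
    funext i
    refine Fin.addCases (fun i => ?_) (fun i => ?_) i
    · rw [Fin.append_left, Fin.append_left]; rfl
    · rw [Fin.append_right, Fin.append_right]; rfl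
  rw [e] at h₁
  exact h₁

variable (T) in
/-- The evaluation functor on all models. -/
noncomputable def evMod : SynCat T ⥤ (Mod.{u, v, w} T ⥤ Type w) where
  obj := evObj
  map {A B} f :=
    { app := fun M => TypeCat.ofHom (SynHom.eval f M)
      naturality := fun M N g => by
        ext x
        exact SynHom.eval_eq f N (Extension.map g x) (Extension.map g (SynHom.eval f M x))
          (SynHom.graph_hom f g _ _ (SynHom.graph_eval f M x)) }
  map_id A := by
    ext M x
    exact SynHom.eval_eq (𝟙 A : A ⟶ A) M x x
      ((realize_idRel (M := M.carrier) A.formula x.1 x.1).2 ⟨x.2, rfl⟩)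
  map_comp {A B C} f g := by
    ext M x
    refine SynHom.eval_eq (f ≫ g) M x (SynHom.eval g M (SynHom.eval f M x)) ?_
    have h₁ := SynHom.graph_eval f M x
    have h₂ := SynHom.graph_eval g M (SynHom.eval f M x)
    generalize SynHom.eval g M (SynHom.eval f M x) = z at h₂ ⊢
    generalize SynHom.eval f M x = y at h₁ h₂
    induction f using Quotient.inductionOn with | _ θ
    induction g using Quotient.inductionOn with | _ χ
    exact (realize_compRel (M := M.carrier) θ.1 χ.1 x.1 z.1).2 ⟨y.1, h₁, h₂⟩

/-- The evaluation functor `Ev : C_T ⥤ Set^𝓜` for a full subcategory `𝓜` of `Mod T`. -/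
noncomputable def Ev (𝓜 : ObjectProperty (Mod.{u, v, w} T)) :
    SynCat T ⥤ (𝓜.FullSubcategory ⥤ Type w) :=
  evMod T ⋙ (Functor.whiskeringLeft _ _ _).obj 𝓜.ι

end Evaluation

/-! ### The theory of a model, and strongly conservative classes of models -/

section Conservative

variable {L : FirstOrder.Language.{u, v}}

theorem realize_onLHom {L' : FirstOrder.Language.{u₁, v₁}} (F : L →ᴸ L') {M : Type w} [L.Structure M]
    [L'.Structure M] [F.IsExpansionOn M] {n : ℕ} (φ : RegFormula L n) (x : Fin n → M) :
    (φ.onLHom F).Realize x ↔ φ.Realize x := by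
  induction φ with
  | top => rfl
  | equal t s => simp [onLHom, Realize]
  | rel R ts => simp [onLHom, Realize]
  | and φ ψ ih₁ ih₂ => simp [onLHom, Realize, ih₁, ih₂]
  | ex φ ih => simp [onLHom, Realize, ih]

/-- The axioms of `T`, read over the signature extended by the elements of `M` as constants. -/
def RegTheory.extend (T : RegTheory L) (M : Type w) : RegTheory L[[M]] :=
  {σ | ∃ τ ∈ T, σ = ⟨τ.ctx, τ.hyp.onLHom (L.lhomWithConstants M),
    τ.concl.onLHom (L.lhomWithConstants M)⟩}

/-- The sequents `⊤ ⊢ φ[d]`, in the empty context, for the Horn formulas `φ` and the tuples `d` of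
elements of `M` with `M ⊨ φ[d]`. -/
def diagramTheory (L : FirstOrder.Language.{u, v}) (M : Type w) [L.Structure M] : RegTheory L[[M]] :=
  {σ | ∃ (n : ℕ) (φ : RegFormula L n) (d : Fin n → M), φ.IsHorn ∧ φ.Realize d ∧
    σ = ⟨0, top, (φ.onLHom (L.lhomWithConstants M)).subst fun i => (L.con (d i)).term⟩}

/-- The theory `T_M` of a model `M` of `T`. -/
def RegTheory.ofModel (T : RegTheory L) (M : Mod.{u, v, w} T) : RegTheory L[[M.carrier]] :=
  T.extend M.carrier ∪ diagramTheory L M.carrier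

/-- The reduct of a `T_M`-model to a `T`-model. -/
def reductMod {T : RegTheory L} {M : Mod.{u, v, w} T} (N : Mod.{max u w, v, w} (T.ofModel M)) :
    Mod.{u, v, w} T :=
  letI : L.Structure N.carrier := (L.lhomWithConstants M.carrier).reduct N.carrier
  { carrier := N.carrier
    isModel := fun σ hσ x h => by
      have := N.isModel _ (Or.inl ⟨σ, hσ, rfl⟩) x
      simp only [realize_onLHom] at this
      exact this h }

/-- `𝓜` is conservative for the regular theory `T`: every regular sequent that is true in all
models in `𝓜` is provable in `T`. -/
def IsConservativeFor (T : RegTheory L) (𝓜 : ObjectProperty (Mod.{u, v, w} T)) : Prop :=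
  ∀ σ : Sequent L, (∀ M : Mod.{u, v, w} T, 𝓜 M → σ.IsTrueIn M.carrier) →
    Derives T σ.hyp σ.concl

/-- `𝓜` is strongly conservative: it is conservative for `T` and, for every `M` in `𝓜`, the class
of all `T_M`-models whose reducts are in `𝓜` is conservative for `T_M`. -/
def IsStronglyConservative (T : RegTheory L) (𝓜 : ObjectProperty (Mod.{u, v, w} T)) : Prop :=
  IsConservativeFor T 𝓜 ∧
    ∀ M : Mod.{u, v, w} T, 𝓜 M → IsConservativeFor (T.ofModel M) fun N => 𝓜 (reductMod N)

end Conservative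

/-! ### Conservative and conditionally sub-Heyting functors -/

section Functors

variable {C : Type u₁} [Category.{v₁} C] {D : Type u₂} [Category.{v₂} D]

/-- The image of a subobject under a functor that preserves monomorphisms. -/
noncomputable def mapSub (F : C ⥤ D) [F.PreservesMonomorphisms] {A : C} (S : Subobject A) :
    Subobject (F.obj A) :=
  Subobject.mk (F.map S.arrow)

/-- `F` preserves all right adjoints to pullback functors that exist in `C`: whenever
`f^* : Sub(B) ⥤ Sub(A)` has a right adjoint `∀_f`, so has `(F f)^*`, and
`∀_{F f}(F S) = F (∀_f S)`. -/
def PreservesForalls [Limits.HasPullbacks C] [Limits.HasPullbacks D] (F : C ⥤ D)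
    [F.PreservesMonomorphisms] : Prop :=
  ∀ ⦃A B : C⦄ (f : A ⟶ B) (R : Subobject A ⥤ Subobject B), (Subobject.pullback f ⊣ R) →
    ∃ R' : Subobject (F.obj A) ⥤ Subobject (F.obj B),
      Nonempty (Subobject.pullback (F.map f) ⊣ R') ∧
        ∀ S : Subobject A, mapSub F (R.obj S) = R'.obj (mapSub F S)

/-- `F` is conditionally sub-Heyting: its domain is a regular category, it is a regular functor
(it preserves finite limits and regular epimorphisms), and it preserves all right adjoints to
pullback functors that exist in its domain. -/
def IsConditionallySubHeyting [Limits.HasPullbacks D] (F : C ⥤ D) : Prop :=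
  ∃ (_ : Regular C) (_ : Limits.PreservesFiniteLimits F),
    (∀ ⦃A B : C⦄ (f : A ⟶ B), IsRegularEpi f → IsRegularEpi (F.map f)) ∧ PreservesForalls F

/-- `F` is conservative: it is faithful and reflects isomorphisms. -/
def IsConservative (F : C ⥤ D) : Prop :=
  F.Faithful ∧ F.ReflectsIsomorphisms

end Functors

end RegularLogic

/-! Conservativity for `T` turns semantics in `𝓜` into syntax. Morphisms of the syntactic category
that define the same functions on all models in `𝓜` are equal (`hom_ext`), and a family of functions
on these models whose graphs are cut out by a single regular formula comes from a morphism
(`exists_hom`). Inverses, factorizations through images, maps out of quotients and maps into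
pullbacks all have regular graphs. Hence isomorphisms, regular epimorphisms and pullbacks in `SynCat
T` are detected pointwise, as bijections, surjections and pullbacks of sets. This yields that `Ev`
is conservative, that `SynCat T` is regular, and that `Ev` is a regular functor.

For universal quantification, the inclusion of `Ev (∀_f S)` in `∀_{Ev f} (Ev S)` is formal.
Conversely, let `y` in `M` belong to the right-hand side: for every `g : M ⟶ N` in `𝓜`, each `x`
with `f(x) = g(y)` lies in `S`. The constants of a model of `T_M` form a homomorphism from `M` to
its reduct, so the sequent `f(x) = y ⊢ S(x)`, with constants for `y`, is true in all models of `T_M`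
with reduct in `𝓜`; by strong conservativity it is provable in `T_M`. A proof uses finitely many
axioms. Replacing the constants in the diagram axioms among them by variables, and quantifying
existentially, gives a regular formula `ψ` that is true of `y` and satisfies `f^*[ψ] ≤ S`
(`exists_formula`). By adjunction `[ψ] ≤ ∀_f S`, so `y` lies in `Ev (∀_f S)`. -/

namespace RegularLogic

open RegFormula

/-! ### Morphisms of the syntactic category as functions on models -/

section Semantics

variable {L : FirstOrder.Language.{u, v}} {T : RegTheory L}

/-- The opposite of a definable relation. -/
def opRel {n m : ℕ} (θ : RegFormula L (n + m)) : RegFormula L (m + n) :=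
  subst₂ θ (vars m n) (vars₀ m n)

theorem realize_opRel {M : Type w} [L.Structure M] {n m : ℕ} (θ : RegFormula L (n + m))
    (x : Fin n → M) (y : Fin m → M) :
    (opRel θ).Realize (Fin.append y x) ↔ θ.Realize (Fin.append x y) := by
  unfold opRel
  rw [realize_subst₂]
  simp [vars, vars₀]

theorem Extension.ext_iff {A : SynCat T} {M : Mod.{u, v, w} T} {x y : Extension A M} :
    x = y ↔ x.1 = y.1 :=
  Subtype.ext_iff

namespace SynHom

/-- A formula representing a morphism of the syntactic category. -/
noncomputable def rel {A B : SynCat T} (f : A ⟶ B) : RegFormula L (A.ctx + B.ctx) :=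
  (Quotient.out (s := homSetoid A B) f).1

theorem isFunctional_rel {A B : SynCat T} (f : A ⟶ B) :
    IsFunctional T A.formula B.formula (rel f) :=
  (Quotient.out (s := homSetoid A B) f).2

theorem mk_rel {A B : SynCat T} (f : A ⟶ B) : SynHom.mk (rel f) (isFunctional_rel f) = f :=
  Quotient.out_eq (s := homSetoid A B) f

theorem graph_iff {A B : SynCat T} (f : A ⟶ B) (M : Mod.{u, v, w} T)
    (x : Fin A.ctx → M.carrier) (y : Fin B.ctx → M.carrier) :
    SynHom.Graph f M x y ↔ (rel f).Realize (Fin.append x y) := by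
  conv_lhs => rw [← mk_rel f]
  rfl

/-- Membership of `y` in the extension of `B` need not be assumed: it follows by soundness from
provable functionality. -/
theorem realize_rel_extension {A B : SynCat T} (f : A ⟶ B) (M : Mod.{u, v, w} T)
    (x : Extension A M) (y : Fin B.ctx → M.carrier) :
    (rel f).Realize (Fin.append x.1 y) ↔ (eval f M x).1 = y := by
  rw [← graph_iff]
  constructor
  · intro h
    have hy : B.formula.Realize y := by
      have := (isFunctional_rel f).cod.sound M _ ((graph_iff f M x.1 y).1 h)
      rw [realize_subst] at this
      simpa [vars] using this
    exact congrArg Subtype.val (eval_eq f M x ⟨y, hy⟩ h)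
  · rintro rfl
    exact graph_eval f M x

theorem realize_rel {A B : SynCat T} (f : A ⟶ B) (M : Mod.{u, v, w} T)
    (x : Fin A.ctx → M.carrier) (y : Fin B.ctx → M.carrier) :
    (rel f).Realize (Fin.append x y) ↔ ∃ x' : Extension A M, x'.1 = x ∧ (eval f M x').1 = y := by
  constructor
  · intro h
    have hx : A.formula.Realize x := by
      have := (isFunctional_rel f).dom.sound M _ h
      rw [realize_subst] at this
      simpa [vars₀] using this
    exact ⟨⟨x, hx⟩, rfl, (realize_rel_extension f M ⟨x, hx⟩ y).1 h⟩
  · rintro ⟨x', rfl, h⟩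
    exact (realize_rel_extension f M x' y).2 h

theorem eval_comp {A B C : SynCat T} (f : A ⟶ B) (g : B ⟶ C) (M : Mod.{u, v, w} T)
    (x : Extension A M) : eval (f ≫ g) M x = eval g M (eval f M x) :=
  congrArg (fun α => α.app M x) ((evMod T).map_comp f g)

theorem eval_id (A : SynCat T) (M : Mod.{u, v, w} T) (x : Extension A M) :
    eval (𝟙 A) M x = x :=
  congrArg (fun α => α.app M x) ((evMod T).map_id A)

end SynHom

open SynHom

/-! ### Constructing morphisms, subobjects, images and pullbacks from their semantics -/

namespace IsConservativeFor

variable {𝓜 : ObjectProperty (Mod.{u, v, w} T)}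

theorem derives (h : IsConservativeFor T 𝓜) {n : ℕ} {φ ψ : RegFormula L n}
    (H : ∀ M : Mod.{u, v, w} T, 𝓜 M → ∀ x : Fin n → M.carrier, φ.Realize x → ψ.Realize x) :
    Derives T φ ψ :=
  h ⟨n, φ, ψ⟩ H

/-- Between functional relations one provable implication is already an equivalence, and
conservativity supplies that implication. -/
theorem hom_ext (h : IsConservativeFor T 𝓜) {A B : SynCat T} {f g : A ⟶ B}
    (H : ∀ M, 𝓜 M → ∀ x, eval f M x = eval g M x) : f = g := by
  rw [← mk_rel f, ← mk_rel g]
  refine SynHom.sound _ _ (h.derives fun M hM z hz => ?_)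
  rw [← Fin.append_castAdd_natAdd (f := z), realize_rel] at hz ⊢
  obtain ⟨x, hx, hy⟩ := hz
  exact ⟨x, hx, H M hM x ▸ hy⟩

/-- A definable family of functions on the models in `𝓜` comes from a morphism of the syntactic
category. -/
theorem exists_hom (h : IsConservativeFor T 𝓜) {A B : SynCat T}
    (g : ∀ M : Mod.{u, v, w} T, 𝓜 M → Extension A M → Extension B M)
    (θ : RegFormula L (A.ctx + B.ctx))
    (hθ : ∀ M hM x y, θ.Realize (Fin.append x.1 y.1) ↔ g M hM x = y) :
    ∃ f : A ⟶ B, ∀ M hM x, eval f M x = g M hM x := by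
  -- The hypothesis on `θ` concerns only tuples in the two extensions, so the graph has to be cut
  -- down to them.
  let χ : RegFormula L (A.ctx + B.ctx) :=
    and (and (A.formula.subst (vars₀ _ _)) (B.formula.subst (vars _ _))) θ
  have hχ : ∀ (M : Mod.{u, v, w} T) (hM : 𝓜 M) (x y), χ.Realize (Fin.append x y) ↔
      ∃ x' : Extension A M, x'.1 = x ∧ (g M hM x').1 = y := by
    intro M hM x y
    simp only [χ, Realize, realize_subst, vars, vars₀, Term.realize_var, Fin.append_left,
      Fin.append_right]
    constructor
    · rintro ⟨⟨hx, hy⟩, hxy⟩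
      exact ⟨⟨x, hx⟩, rfl, congrArg Subtype.val ((hθ M hM ⟨x, hx⟩ ⟨y, hy⟩).1 hxy)⟩
    · rintro ⟨x', rfl, rfl⟩
      exact ⟨⟨x'.2, (g M hM x').2⟩, (hθ M hM _ _).2 rfl⟩
  -- Each clause of functionality is a regular sequent, hence provable as soon as it is true in `𝓜`.
  have hf : IsFunctional T A.formula B.formula χ := by
    refine ⟨h.derives fun M hM z hz => hz.1.1, h.derives fun M hM z hz => hz.1.2,
      h.derives fun M hM x hx => ?_, h.derives fun M hM z hz => ?_⟩
    · rw [realize_exs]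
      exact ⟨(g M hM ⟨x, hx⟩).1, (hχ M hM _ _).2 ⟨⟨x, hx⟩, rfl, rfl⟩⟩
    · simp only [Realize, realize_subst₂, realize_eqs, hχ M hM] at hz ⊢
      obtain ⟨⟨x, hx, hy⟩, ⟨x', hx', hy'⟩⟩ := hz
      obtain rfl := Subtype.ext (hx.trans hx'.symm)
      exact fun j => congrFun (hy.symm.trans hy') j
  exact ⟨SynHom.mk χ hf, fun M hM x =>
    eval_eq _ M x (g M hM x) ((hχ M hM x.1 _).2 ⟨x, rfl, rfl⟩)⟩

theorem isIso_iff (h : IsConservativeFor T 𝓜) {A B : SynCat T} (f : A ⟶ B) :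
    IsIso f ↔ ∀ M, 𝓜 M → Function.Bijective (eval f M) := by
  constructor
  · intro _ M _
    refine Function.bijective_iff_has_inverse.2 ⟨eval (inv f) M, fun x => ?_, fun x => ?_⟩
    · rw [← eval_comp, IsIso.hom_inv_id, eval_id]
    · rw [← eval_comp, IsIso.inv_hom_id, eval_id]
  · intro H
    -- The pointwise inverse is definable because its graph is the opposite relation.
    obtain ⟨g, hg⟩ := h.exists_hom (A := B) (B := A)
      (fun M hM => (Equiv.ofBijective _ (H M hM)).symm) (opRel (rel f)) (fun M hM x y => by
        rw [realize_opRel, realize_rel_extension, Equiv.symm_apply_eq, Extension.ext_iff]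
        exact eq_comm)
    refine ⟨g, h.hom_ext fun M hM x => ?_, h.hom_ext fun M hM x => ?_⟩
    · rw [eval_comp, hg M hM, eval_id]
      exact (Equiv.ofBijective _ (H M hM)).symm_apply_apply x
    · rw [eval_comp, hg M hM, eval_id]
      exact (Equiv.ofBijective _ (H M hM)).apply_symm_apply x

theorem mono (h : IsConservativeFor T 𝓜) {A B : SynCat T} (f : A ⟶ B)
    (H : ∀ M, 𝓜 M → Function.Injective (eval f M)) : Mono f :=
  ⟨fun a b hab => h.hom_ext fun M hM x => H M hM (by rw [← eval_comp, ← eval_comp, hab])⟩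

/-- The lift has the regular graph `∃ z, f(x) = z ∧ m(s) = z`, which is single-valued because `m` is
injective. -/
theorem exists_lift (h : IsConservativeFor T 𝓜) {A S B : SynCat T} (f : A ⟶ B) (m : S ⟶ B)
    (hm : ∀ M, 𝓜 M → Function.Injective (eval m M))
    (H : ∀ M, 𝓜 M → ∀ x, eval f M x ∈ Set.range (eval m M)) : ∃ e : A ⟶ S, e ≫ m = f := by
  choose g hg using H
  obtain ⟨e, he⟩ := h.exists_hom g (compRel (rel f) (opRel (rel m))) (fun M hM x s => by
    simp only [realize_compRel, realize_opRel, realize_rel_extension]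
    rw [exists_eq_left', ← Extension.ext_iff, ← hg M hM, (hm M hM).eq_iff, eq_comm])
  exact ⟨e, h.hom_ext fun M hM x => by rw [eval_comp, he M hM, hg]⟩

/-- The induced map has the regular graph `∃ x, f(x) = y ∧ g(x) = z`: surjectivity of `f` makes it
total, and `H` makes it single-valued. -/
theorem exists_desc (h : IsConservativeFor T 𝓜) {A B C : SynCat T} (f : A ⟶ B) (g : A ⟶ C)
    (hf : ∀ M, 𝓜 M → Function.Surjective (eval f M))
    (H : ∀ M, 𝓜 M → ∀ x x', eval f M x = eval f M x' → eval g M x = eval g M x') :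
    ∃ d : B ⟶ C, f ≫ d = g := by
  choose s hs using hf
  obtain ⟨d, hd⟩ := h.exists_hom (fun M hM y => eval g M (s M hM y))
    (compRel (opRel (rel f)) (rel g)) (fun M hM y z => by
    simp only [realize_compRel, realize_opRel]
    constructor
    · rintro ⟨x, hx, hz⟩
      obtain ⟨x, rfl, hx'⟩ := (realize_rel _ _ _ _).1 hx
      rw [realize_rel_extension] at hz
      rw [← Subtype.ext hz]
      exact H M hM _ _ ((hs M hM y).trans (Subtype.ext hx'.symm))
    · rintro rfl
      refine ⟨(s M hM y).1, ?_⟩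
      rw [realize_rel_extension, realize_rel_extension, hs]
      exact ⟨rfl, rfl⟩)
  exact ⟨d, h.hom_ext fun M hM x => by
    rw [eval_comp, hd M hM]; exact H M hM _ _ (hs M hM _)⟩

/-- Comprehension: a formula in the context of `A` defines a subobject of `A`. -/
theorem exists_sub (h : IsConservativeFor T 𝓜) (A : SynCat T) (φ : RegFormula L A.ctx) :
    ∃ (S : SynCat T) (m : S ⟶ A), ∀ M, 𝓜 M → Function.Injective (eval m M) ∧
      ∀ x, x ∈ Set.range (eval m M) ↔ φ.Realize x.1 := by
  let S : SynCat T := ⟨A.ctx, and A.formula φ⟩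
  have g : ∀ (M : Mod.{u, v, w} T) (x : Extension S M), ∃ y : Extension A M, y.1 = x.1 :=
    fun M x => ⟨⟨x.1, x.2.1⟩, rfl⟩
  choose g hg using g
  -- The inclusion does not change tuples, so its graph is a conjunction of equations.
  obtain ⟨m, hm⟩ := h.exists_hom (fun M _ => g M) (eqs A.ctx (vars₀ A.ctx A.ctx) (vars A.ctx A.ctx))
    (fun M hM x y => by
      rw [realize_eqs, Extension.ext_iff, funext_iff, hg]
      simp [vars, vars₀, S, -Fin.natAdd_eq_addNat])
  refine ⟨_, m, fun M hM => ⟨fun x y hxy => ?_, fun x => ⟨?_, fun hx => ?_⟩⟩⟩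
  · rw [hm M hM, hm M hM, Extension.ext_iff, hg, hg] at hxy
    exact Subtype.ext hxy
  · rintro ⟨s, rfl⟩
    rw [hm M hM, hg]
    exact s.2.2
  · exact ⟨⟨x.1, x.2, hx⟩, (hm M hM _).trans (Extension.ext_iff.2 (hg M _))⟩

end IsConservativeFor

/-- The formula defining the image of a morphism. -/
noncomputable def imgFormula {A B : SynCat T} (f : A ⟶ B) : RegFormula L B.ctx :=
  exs A.ctx (opRel (rel f))

theorem realize_imgFormula {A B : SynCat T} (f : A ⟶ B) (M : Mod.{u, v, w} T)
    (y : Fin B.ctx → M.carrier) :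
    (imgFormula f).Realize y ↔ ∃ x, (eval f M x).1 = y := by
  unfold imgFormula
  rw [realize_exs]
  simp only [realize_opRel, realize_rel]
  exact ⟨fun ⟨_, x, _, hx⟩ => ⟨x, hx⟩, fun ⟨x, hx⟩ => ⟨_, x, rfl, hx⟩⟩

namespace IsConservativeFor

variable {𝓜 : ObjectProperty (Mod.{u, v, w} T)}

/-- The image is defined by an existential, hence regular, formula; comprehension makes it a
subobject, and `f` lifts to it. -/
theorem exists_image (h : IsConservativeFor T 𝓜) {A B : SynCat T} (f : A ⟶ B) :
    ∃ (I : SynCat T) (e : A ⟶ I) (m : I ⟶ B), e ≫ m = f ∧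
      (∀ M, 𝓜 M → Function.Surjective (eval e M)) ∧
      ∀ M, 𝓜 M → Function.Injective (eval m M) := by
  obtain ⟨I, m, hm⟩ := h.exists_sub B (imgFormula f)
  obtain ⟨e, he⟩ := h.exists_lift f m (fun M hM => (hm M hM).1) (fun M hM x => by
    rw [(hm M hM).2, realize_imgFormula]
    exact ⟨x, rfl⟩)
  refine ⟨I, e, m, he, fun M hM s => ?_, fun M hM => (hm M hM).1⟩
  obtain ⟨x, hx⟩ := (realize_imgFormula f M _).1 (((hm M hM).2 (eval m M s)).1 ⟨s, rfl⟩)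
  refine ⟨x, (hm M hM).1 ?_⟩
  rw [← eval_comp, he]
  exact Subtype.ext hx

/-- Being a pullback in every model of `𝓜` suffices, since the map induced by `a` and `b` has the
regular graph `a(x) = p(y) ∧ b(x) = q(y)`. -/
theorem isPullback (h : IsConservativeFor T 𝓜) {P A B C : SynCat T} {p : P ⟶ A} {q : P ⟶ B}
    {f : A ⟶ C} {g : B ⟶ C} (w : p ≫ f = q ≫ g)
    (inj : ∀ M, 𝓜 M → ∀ x y, eval p M x = eval p M y → eval q M x = eval q M y → x = y)
    (surj : ∀ M, 𝓜 M → ∀ a b, eval f M a = eval g M b →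
      ∃ x, eval p M x = a ∧ eval q M x = b) : IsPullback p q f g := by
  have lift : ∀ {W : SynCat T} (a : W ⟶ A) (b : W ⟶ B), a ≫ f = b ≫ g →
      ∃ l : W ⟶ P, l ≫ p = a ∧ l ≫ q = b := by
    intro W a b hab
    have : ∀ M, 𝓜 M → ∀ x, ∃ y, eval p M y = eval a M x ∧ eval q M y = eval b M x :=
      fun M hM x => surj M hM _ _ (by rw [← eval_comp, ← eval_comp, hab])
    choose l hl₁ hl₂ using this
    obtain ⟨l', hl'⟩ := h.exists_hom l (and (compRel (rel a) (opRel (rel p)))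
      (compRel (rel b) (opRel (rel q)))) (fun M hM x y => by
        simp only [Realize, realize_compRel, realize_opRel, realize_rel_extension]
        rw [exists_eq_left', exists_eq_left', ← Extension.ext_iff, ← Extension.ext_iff,
          ← hl₁ M hM, ← hl₂ M hM]
        exact ⟨fun hy => inj M hM _ _ hy.1.symm hy.2.symm, fun hy => by rw [hy]; exact ⟨rfl, rfl⟩⟩)
    exact ⟨l', h.hom_ext fun M hM x => by rw [eval_comp, hl' M hM, hl₁],
      h.hom_ext fun M hM x => by rw [eval_comp, hl' M hM, hl₂]⟩
  refine ⟨⟨w⟩, ⟨Limits.PullbackCone.IsLimit.mk w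
    (fun s => (lift s.fst s.snd s.condition).choose)
    (fun s => (lift s.fst s.snd s.condition).choose_spec.1)
    (fun s => (lift s.fst s.snd s.condition).choose_spec.2)
    (fun s m hm₁ hm₂ => h.hom_ext fun M hM x => ?_)⟩⟩
  have hs := (lift s.fst s.snd s.condition).choose_spec
  refine inj M hM _ _ ?_ ?_
  · rw [← eval_comp, ← eval_comp, hm₁, hs.1]
  · rw [← eval_comp, ← eval_comp, hm₂, hs.2]

theorem exists_pullback (h : IsConservativeFor T 𝓜) {A B C : SynCat T} (f : A ⟶ C)
    (g : B ⟶ C) : ∃ (P : SynCat T) (p : P ⟶ A) (q : P ⟶ B), p ≫ f = q ≫ g ∧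
      (∀ M, 𝓜 M → ∀ x y, eval p M x = eval p M y → eval q M x = eval q M y → x = y) ∧
      ∀ M, 𝓜 M → ∀ a b, eval f M a = eval g M b → ∃ x, eval p M x = a ∧ eval q M x = b := by
  -- The formula is `∃ c, f(a) = c ∧ g(b) = c` in the variables `(a, b)`.
  let P : SynCat T := ⟨A.ctx + B.ctx, compRel (rel f) (opRel (rel g))⟩
  have hP : ∀ (M : Mod.{u, v, w} T) (z : Fin P.ctx → M.carrier), P.formula.Realize z ↔
      ∃ (a : Extension A M) (b : Extension B M), eval f M a = eval g M b ∧
        Fin.append a.1 b.1 = z := by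
    intro M z
    rw [← Fin.append_castAdd_natAdd (f := z)]
    simp only [P, realize_compRel, realize_opRel, realize_rel]
    constructor
    · rintro ⟨c, ⟨a, ha, ha'⟩, ⟨b, hb, hb'⟩⟩
      exact ⟨a, b, Subtype.ext (ha'.trans hb'.symm), by rw [ha, hb]⟩
    · rintro ⟨a, b, hab, hz⟩
      refine ⟨_, ⟨a, ?_, rfl⟩, ⟨b, ?_, by rw [hab]⟩⟩
      · funext i
        simpa using congrFun hz (Fin.castAdd _ i)
      · funext i
        simpa using congrFun hz (Fin.natAdd _ i)
  have hP' : ∀ (M : Mod.{u, v, w} T) (z : Extension P M), ∃ (a : Extension A M)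
      (b : Extension B M), eval f M a = eval g M b ∧ Fin.append a.1 b.1 = z.1 :=
    fun M z => (hP M z.1).1 z.2
  choose a b hab hz using hP'
  obtain ⟨p, hp⟩ := h.exists_hom (A := P) (B := A) (fun M _ => a M)
    -- In the context `(a, b), x` this says `a = x`; the formula for `q` compares the block `b`
    -- instead.
    (eqs A.ctx (fun i => Term.var (Fin.castAdd _ (Fin.castAdd _ i))) (vars P.ctx A.ctx))
    (fun M _ z x => by
      rw [realize_eqs, Extension.ext_iff, funext_iff]
      refine forall_congr' fun i => ?_
      rw [← hz]
      simp [vars, -Fin.natAdd_eq_addNat])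
  obtain ⟨q, hq⟩ := h.exists_hom (A := P) (B := B) (fun M _ => b M)
    (eqs B.ctx (fun i => Term.var (Fin.castAdd _ (Fin.natAdd _ i))) (vars P.ctx B.ctx))
    (fun M _ z x => by
      rw [realize_eqs, Extension.ext_iff, funext_iff]
      refine forall_congr' fun i => ?_
      rw [← hz]
      simp [vars, -Fin.natAdd_eq_addNat])
  refine ⟨P, p, q, h.hom_ext fun M hM z => ?_, fun M hM z z' h₁ h₂ => ?_, fun M hM x y hxy => ?_⟩
  · rw [eval_comp, eval_comp, hp M hM, hq M hM, hab]
  · rw [hp M hM, hp M hM] at h₁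
    rw [hq M hM, hq M hM] at h₂
    refine Subtype.ext ?_
    rw [← hz, ← hz, h₁, h₂]
  · obtain ⟨z, hz'⟩ : ∃ z : Extension P M, z.1 = Fin.append x.1 y.1 :=
      ⟨⟨_, (hP M _).2 ⟨x, y, hxy, rfl⟩⟩, rfl⟩
    rw [← hz] at hz'
    refine ⟨z, (hp M hM z).trans (Subtype.ext (funext fun i => ?_)),
      (hq M hM z).trans (Subtype.ext (funext fun i => ?_))⟩
    · simpa using congrFun hz' (Fin.castAdd _ i)
    · simpa using congrFun hz' (Fin.natAdd _ i)

end IsConservativeFor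

end Semantics

/-! ### Regularity of the syntactic category and of the evaluation functor -/

section Regular

variable {L : FirstOrder.Language.{u, v}} {T : RegTheory L}
  {𝓜 : ObjectProperty (Mod.{u, v, w} T)}

open SynHom Limits

namespace IsConservativeFor

/-- The object of the syntactic category given by the empty context and truth is terminal. -/
theorem nonempty_isTerminal (h : IsConservativeFor T 𝓜) :
    Nonempty (IsTerminal (⟨0, top⟩ : SynCat T)) := by
  have hs : ∀ M : Mod.{u, v, w} T, Subsingleton (Extension (⟨0, top⟩ : SynCat T) M) :=
    fun M => ⟨fun x y => Subtype.ext (funext fun i => i.elim0)⟩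
  have hf : ∀ A : SynCat T, ∃ _ : A ⟶ (⟨0, top⟩ : SynCat T), True := fun A => by
    obtain ⟨f, -⟩ := h.exists_hom (A := A) (B := ⟨0, top⟩)
      (fun M _ _ => ⟨fun i => i.elim0, trivial⟩) top
      (fun M _ x y => ⟨fun _ => (hs M).elim _ _, fun _ => trivial⟩)
    exact ⟨f, trivial⟩
  exact ⟨IsTerminal.ofUniqueHom (fun A => (hf A).choose)
    fun A m => h.hom_ext fun M _ x => (hs M).elim _ _⟩

theorem hasFiniteLimits (h : IsConservativeFor T 𝓜) : HasFiniteLimits (SynCat T) := by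
  have : HasTerminal (SynCat T) := h.nonempty_isTerminal.some.hasTerminal
  have : HasPullbacks (SynCat T) := by
    have : ∀ {A B C : SynCat T} {f : A ⟶ C} {g : B ⟶ C}, HasLimit (cospan f g) := by
      intro A B C f g
      obtain ⟨P, p, q, w, inj, surj⟩ := h.exists_pullback f g
      exact (h.isPullback w inj surj).hasPullback
    exact hasPullbacks_of_hasLimit_cospan _
  exact hasFiniteLimits_of_hasTerminal_and_pullbacks

/-- An arbitrary pullback is compared with the explicit one from `exists_pullback`, where both
properties are known. -/
theorem eval_of_isPullback (h : IsConservativeFor T 𝓜) {P A B C : SynCat T} {p : P ⟶ A}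
    {q : P ⟶ B} {f : A ⟶ C} {g : B ⟶ C} (sq : IsPullback p q f g) {M : Mod.{u, v, w} T}
    (hM : 𝓜 M) :
    (∀ x y, eval p M x = eval p M y → eval q M x = eval q M y → x = y) ∧
      ∀ a b, eval f M a = eval g M b → ∃ x, eval p M x = a ∧ eval q M x = b := by
  obtain ⟨P', p', q', w, inj, surj⟩ := h.exists_pullback f g
  have sq' := h.isPullback w inj surj
  have hk : sq'.lift p q sq.w ≫ sq.lift p' q' w = 𝟙 P := sq.hom_ext (by simp) (by simp)
  constructor
  · intro x y hx hy
    have : eval (sq'.lift p q sq.w) M x = eval (sq'.lift p q sq.w) M y := by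
      refine inj M hM _ _ ?_ ?_
      · simpa only [← eval_comp, sq'.lift_fst] using hx
      · simpa only [← eval_comp, sq'.lift_snd] using hy
    have := congrArg (eval (sq.lift p' q' w) M) this
    simpa only [← eval_comp, hk, eval_id] using this
  · intro a b hab
    obtain ⟨x, rfl, rfl⟩ := surj M hM a b hab
    exact ⟨eval (sq.lift p' q' w) M x, by rw [← eval_comp, sq.lift_fst],
      by rw [← eval_comp, sq.lift_snd]⟩

/-- For a regular epimorphism, the monic part of the image factorization is also a strong
epimorphism, hence invertible. Conversely, a pointwise surjection is the coequalizer of its kernel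
pair by `exists_desc`. -/
theorem isRegularEpi_iff (h : IsConservativeFor T 𝓜) {A B : SynCat T} (f : A ⟶ B) :
    IsRegularEpi f ↔ ∀ M, 𝓜 M → Function.Surjective (eval f M) := by
  constructor
  · intro _ M hM
    obtain ⟨I, e, m, rfl, he, hm⟩ := h.exists_image f
    have : HasFiniteLimits (SynCat T) := h.hasFiniteLimits
    have := h.mono m hm
    have : StrongEpi m := strongEpi_of_strongEpi e m
    have : IsIso m := isIso_of_mono_of_strongEpi m
    intro y
    obtain ⟨z, rfl⟩ := ((h.isIso_iff m).1 this M hM).2 y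
    obtain ⟨x, rfl⟩ := he M hM z
    exact ⟨x, eval_comp _ _ _ _⟩
  · intro H
    obtain ⟨P, p, q, w, -, surj⟩ := h.exists_pullback f f
    have desc : ∀ s : Cofork p q, ∃ d : B ⟶ s.pt, f ≫ d = s.π := fun s => by
      refine h.exists_desc f s.π H fun M hM x x' hx => ?_
      obtain ⟨y, rfl, rfl⟩ := surj M hM x x' hx
      rw [← eval_comp, ← eval_comp]
      exact congrArg (fun a => eval a M y) s.condition
    exact ⟨⟨{
      W := P
      left := p
      right := q
      w := w
      isColimit := Cofork.IsColimit.mk _ (fun s => (desc s).choose)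
        (fun s => (desc s).choose_spec) (fun s m hm => h.hom_ext fun M hM y => by
          obtain ⟨x, rfl⟩ := H M hM y
          rw [← eval_comp, ← eval_comp, (desc s).choose_spec]
          exact congrArg (fun a => eval a M x) hm) }⟩⟩

/-- The syntactic category of a regular theory with enough models is regular. -/
theorem regular (h : IsConservativeFor T 𝓜) : Regular (SynCat T) where
  toHasFiniteLimits := h.hasFiniteLimits
  hasCoequalizer_of_isKernelPair := by
    intro X Y Z f g₁ g₂ hf
    obtain ⟨I, e, m, rfl, he, hm⟩ := h.exists_image f
    have := h.mono m hm
    have : IsRegularEpi e := (h.isRegularEpi_iff e).2 he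
    -- As `m` is monic, `e` has the same kernel pair as `e ≫ m`, and a regular epimorphism is the
    -- coequalizer of its kernel pair.
    have k : IsKernelPair e g₁ g₂ := hf.cancel_right_of_mono
    exact ⟨⟨_, k.toCoequalizer'⟩⟩
  regularEpiIsStableUnderBaseChange := by
    refine ⟨fun {_ _ _ _} f g f' g' sq hg => ?_⟩
    rw [MorphismProperty.regularEpi_iff, h.isRegularEpi_iff] at hg ⊢
    intro M hM y
    obtain ⟨x, hx⟩ := hg M hM (eval f M y)
    obtain ⟨z, -, hz⟩ := (h.eval_of_isPullback sq hM).2 x y hx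
    exact ⟨z, hz⟩

theorem isPullback_map_Ev (h : IsConservativeFor T 𝓜) {P A B C : SynCat T} {p : P ⟶ A}
    {q : P ⟶ B} {f : A ⟶ C} {g : B ⟶ C} (sq : IsPullback p q f g) :
    IsPullback ((Ev 𝓜).map p) ((Ev 𝓜).map q) ((Ev 𝓜).map f) ((Ev 𝓜).map g) := by
  refine IsPullback.of_forall_isPullback_app fun M => ?_
  rw [Types.isPullback_iff]
  refine ⟨?_, fun x y hxy => (h.eval_of_isPullback sq M.2).1 x y hxy.1 hxy.2,
    (h.eval_of_isPullback sq M.2).2⟩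
  rw [← NatTrans.comp_app, ← NatTrans.comp_app, ← Functor.map_comp, ← Functor.map_comp, sq.w]

theorem preservesFiniteLimits_Ev (h : IsConservativeFor T 𝓜) :
    PreservesFiniteLimits (Ev 𝓜) := by
  have := h.hasFiniteLimits
  have : PreservesLimitsOfShape WalkingCospan (Ev 𝓜) := by
    refine ⟨fun {K} => ?_⟩
    have : PreservesLimit (cospan (K.map WalkingCospan.Hom.inl) (K.map WalkingCospan.Hom.inr))
        (Ev 𝓜) := by
      have sq := IsPullback.of_hasPullback (K.map WalkingCospan.Hom.inl)
        (K.map WalkingCospan.Hom.inr)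
      exact preservesLimit_of_preserves_limit_cone sq.isLimit
        ((isLimitMapConePullbackConeEquiv (Ev 𝓜) sq.w).symm (h.isPullback_map_Ev sq).isLimit)
    exact preservesLimit_of_iso_diagram _ (diagramIsoCospan K).symm
  have : PreservesLimitsOfShape (Discrete PEmpty.{1}) (Ev 𝓜) := by
    have : PreservesLimit (Functor.empty.{0} (SynCat T)) (Ev 𝓜) := by
      refine preservesLimit_of_preserves_limit_cone h.nonempty_isTerminal.some
        ((isLimitMapConeEmptyConeEquiv (Ev 𝓜) _).symm (IsTerminal.ofUniqueHom
          -- The empty tuple is the unique point of the extension, even when the domain is empty.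
          (fun F => { app := fun M => ↾fun _ => ⟨fun i => i.elim0, trivial⟩
                      naturality := fun M N g => ?_ }) fun F m => ?_))
      · ext x
        exact Subtype.ext (funext fun i => i.elim0)
      · ext M x
        exact Subtype.ext (funext fun i => i.elim0)
    exact preservesLimitsOfShape_pempty_of_preservesTerminal _
  exact preservesFiniteLimits_of_preservesTerminal_and_pullbacks _

/-- For set-valued functors, epimorphisms are the pointwise surjections and all of them are regular.
-/
theorem isRegularEpi_map_Ev (h : IsConservativeFor T 𝓜) {A B : SynCat T} (f : A ⟶ B)
    (hf : IsRegularEpi f) : IsRegularEpi ((Ev 𝓜).map f) := by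
  have : Epi ((Ev 𝓜).map f) := by
    rw [NatTrans.epi_iff_epi_app]
    intro M
    rw [epi_iff_surjective]
    exact (h.isRegularEpi_iff f).1 hf M.1 M.2
  exact isRegularEpi_of_regularEpi (IsRegularEpiCategory.regularEpiOfEpi _).getStruct

theorem isConservative_Ev (h : IsConservativeFor T 𝓜) : IsConservative (Ev 𝓜) := by
  refine ⟨⟨fun {A B f g} hfg => h.hom_ext fun M hM x => ?_⟩, ⟨fun {A B} f hf => ?_⟩⟩
  · exact congrArg (fun α => α.app ⟨M, hM⟩ x) hfg
  · rw [h.isIso_iff]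
    intro M hM
    have : IsIso (((Ev 𝓜).map f).app ⟨M, hM⟩) := inferInstance
    exact (isIso_iff_bijective _).1 this

end IsConservativeFor

end Regular

/-! ### Finiteness of derivations and the theory of a model -/

section Diagram

variable {L : FirstOrder.Language.{u, v}}

theorem Derives.mono {T T' : RegTheory L} (hT : T ⊆ T') {n : ℕ} {φ ψ : RegFormula L n}
    (h : Derives T φ ψ) : Derives T' φ ψ := by
  induction h with
  | ax σ h => exact .ax σ (hT h)
  | refl φ => exact .refl φ
  | cut _ _ ih₁ ih₂ => exact .cut ih₁ ih₂
  | subst σ _ ih => exact .subst σ ih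
  | eq_refl t => exact .eq_refl t
  | eq_subst t s φ => exact .eq_subst t s φ
  | top_intro φ => exact .top_intro φ
  | and_left φ ψ => exact .and_left φ ψ
  | and_right φ ψ => exact .and_right φ ψ
  | and_intro _ _ ih₁ ih₂ => exact .and_intro ih₁ ih₂
  | ex_left _ ih => exact .ex_left ih
  | ex_right _ ih => exact .ex_right ih
  | frobenius φ ψ => exact .frobenius φ ψ

/-- Derivations use only finitely many axioms. -/
theorem Derives.exists_finite {T : RegTheory L} {n : ℕ} {φ ψ : RegFormula L n}
    (h : Derives T φ ψ) : ∃ S : RegTheory L, S ⊆ T ∧ S.Finite ∧ Derives S φ ψ := by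
  have two : ∀ {n m k : ℕ} {φ ψ : RegFormula L n} {φ' ψ' : RegFormula L m}
      {φ'' ψ'' : RegFormula L k}, (∃ S : RegTheory L, S ⊆ T ∧ S.Finite ∧ Derives S φ ψ) →
      (∃ S : RegTheory L, S ⊆ T ∧ S.Finite ∧ Derives S φ' ψ') →
      (∀ S, Derives S φ ψ → Derives S φ' ψ' → Derives S φ'' ψ'') →
      ∃ S : RegTheory L, S ⊆ T ∧ S.Finite ∧ Derives S φ'' ψ'' := by
    rintro n m k φ ψ φ' ψ' φ'' ψ'' ⟨S, hS, fS, h⟩ ⟨S', hS', fS', h'⟩ H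
    exact ⟨S ∪ S', Set.union_subset hS hS', fS.union fS',
      H _ (h.mono Set.subset_union_left) (h'.mono Set.subset_union_right)⟩
  have zero : ∀ {n : ℕ} {φ ψ : RegFormula L n}, Derives ∅ φ ψ →
      ∃ S : RegTheory L, S ⊆ T ∧ S.Finite ∧ Derives S φ ψ :=
    fun h => ⟨∅, Set.empty_subset _, Set.finite_empty, h⟩
  induction h with
  | ax σ h => exact ⟨{σ}, Set.singleton_subset_iff.2 h, Set.finite_singleton _, .ax σ rfl⟩
  | refl φ => exact zero (.refl φ)
  | cut _ _ ih₁ ih₂ => exact two ih₁ ih₂ fun _ => .cut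
  | subst σ _ ih => exact two ih ih fun _ h _ => .subst σ h
  | eq_refl t => exact zero (.eq_refl t)
  | eq_subst t s φ => exact zero (.eq_subst t s φ)
  | top_intro φ => exact zero (.top_intro φ)
  | and_left φ ψ => exact zero (.and_left φ ψ)
  | and_right φ ψ => exact zero (.and_right φ ψ)
  | and_intro _ _ ih₁ ih₂ => exact two ih₁ ih₂ fun _ => .and_intro
  | ex_left _ ih => exact two ih ih fun _ h _ => .ex_left h
  | ex_right _ ih => exact two ih ih fun _ h _ => .ex_right h
  | frobenius φ ψ => exact zero (.frobenius φ ψ)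

/-- Truth of a sequent over the signature with constants from `M`, when the constants are
interpreted by `c : M → N`. -/
def Sequent.IsTrueVia {M : Type w} (σ : Sequent L[[M]]) {N : Type w} [L.Structure N]
    (c : M → N) : Prop :=
  letI := constantsOn.structure c
  σ.IsTrueIn N

theorem realize_subst_con {M : Type w} {N : Type u₁} [L.Structure N] [L[[M]].Structure N]
    [(L.lhomWithConstants M).IsExpansionOn N] {n m : ℕ} (φ : RegFormula L n) (d : Fin n → M)
    (x : Fin m → N) :
    ((φ.onLHom (L.lhomWithConstants M)).subst fun i => (L.con (d i)).term).Realize x ↔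
      φ.Realize fun i => (L.con (d i) : N) := by
  rw [realize_subst, realize_onLHom]
  simp only [Term.realize_constants]

theorem isTrueVia_diagram {M N : Type w} [L.Structure N] (c : M → N) {n : ℕ}
    (φ : RegFormula L n) (d : Fin n → M) :
    Sequent.IsTrueVia (⟨0, top, (φ.onLHom (L.lhomWithConstants M)).subst
      fun i => (L.con (d i)).term⟩ : Sequent L[[M]]) c ↔ φ.Realize fun i => c (d i) := by
  let := constantsOn.structure c
  exact ⟨fun h => (realize_subst_con φ d _).1 (h default trivial),
    fun h x _ => (realize_subst_con φ d x).2 h⟩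

theorem isTrueVia_onLHom {M N : Type w} [L.Structure N] (c : M → N) (σ : Sequent L)
    (hσ : σ.IsTrueIn N) :
    Sequent.IsTrueVia (⟨σ.ctx, σ.hyp.onLHom (L.lhomWithConstants M),
      σ.concl.onLHom (L.lhomWithConstants M)⟩ : Sequent L[[M]]) c := by
  let := constantsOn.structure c
  intro x hx
  simp only [realize_onLHom] at hx ⊢
  exact hσ x hx

/-- A finite part of the theory of a model `M` holds as soon as the constants satisfy a single
formula that is true in `M`. -/
theorem exists_formula_of_finite {T : RegTheory L} (M : Mod.{u, v, w} T)
    {S : RegTheory L[[M.carrier]]} (hS : S ⊆ T.ofModel M) (fS : S.Finite) :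
    ∃ (k : ℕ) (χ : RegFormula L k) (e : Fin k → M.carrier),
      (Nonempty M.carrier → 0 < k) ∧ χ.Realize e ∧
      ∀ (N : Mod.{u, v, w} T) (c : M.carrier → N.carrier), (χ.Realize fun i => c (e i)) →
        ∀ σ ∈ S, σ.IsTrueVia c := by
  induction S, fS using Set.Finite.induction_on with
  | empty =>
    -- For inhabited `M` a dummy variable is included to secure `0 < k`; an empty `M` has no element
    -- to assign to it.
    by_cases hM : Nonempty M.carrier
    · exact ⟨1, top, fun _ => hM.some, fun _ => one_pos, trivial, fun _ _ _ _ h => h.elim⟩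
    · exact ⟨0, top, fun i => i.elim0, fun h => (hM h).elim, trivial, fun _ _ _ _ h => h.elim⟩
  | @insert σ S _ _ ih =>
    obtain ⟨k, χ, e, hk, he, H⟩ := ih ((Set.subset_insert _ _).trans hS)
    rcases hS (Set.mem_insert σ S) with ⟨τ, hτ, rfl⟩ | ⟨n, φ, d, -, hφ, rfl⟩
    -- An axiom of `T` contains no new constants, so it holds in `N` for every `c` and adds nothing
    -- to `χ`.
    · refine ⟨k, χ, e, hk, he, fun N c hc σ hσ => ?_⟩
      rcases Set.mem_insert_iff.1 hσ with rfl | hσ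
      · exact isTrueVia_onLHom c τ (N.isModel τ hτ)
      · exact H N c hc σ hσ
    -- A diagram axiom `φ[d]` contributes a conjunct `φ` on fresh variables, to be evaluated at `d`.
    · have key : ∀ (N : Mod.{u, v, w} T) (c : M.carrier → N.carrier),
          ((and (χ.subst (vars₀ k n)) (φ.subst (vars k n))).Realize
            fun i => c (Fin.append e d i)) ↔
            (χ.Realize fun i => c (e i)) ∧ φ.Realize fun i => c (d i) := by
        intro N c
        simp [Realize, realize_subst, vars, vars₀, -Fin.natAdd_eq_addNat]
      refine ⟨k + n, and (χ.subst (vars₀ k n)) (φ.subst (vars k n)), Fin.append e d,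
        fun hM => Nat.add_pos_left (hk hM) n, (key M id).2 ⟨he, hφ⟩, fun N c hc σ hσ => ?_⟩
      rcases Set.mem_insert_iff.1 hσ with rfl | hσ
      · exact (isTrueVia_diagram c φ d).2 ((key N c).1 hc).2
      · exact H N c ((key N c).1 hc).1 σ hσ

/-- Under `c`, the structure `N` need only satisfy the finitely many axioms used in the derivation;
in particular `c` need not be a homomorphism. -/
theorem Derives.isTrueVia {T : RegTheory L} {M : Mod.{u, v, w} T}
    {σ : Sequent L[[M.carrier]]} (h : Derives (T.ofModel M) σ.hyp σ.concl) :
    ∃ (k : ℕ) (χ : RegFormula L k) (e : Fin k → M.carrier),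
      (Nonempty M.carrier → 0 < k) ∧ χ.Realize e ∧
      ∀ (N : Mod.{u, v, w} T) (c : M.carrier → N.carrier), (χ.Realize fun i => c (e i)) →
        σ.IsTrueVia c := by
  obtain ⟨S, hS, fS, h⟩ := h.exists_finite
  obtain ⟨k, χ, e, hk, he, H⟩ := exists_formula_of_finite M hS fS
  refine ⟨k, χ, e, hk, he, fun N c hc => ?_⟩
  let := constantsOn.structure c
  exact h.sound { carrier := N.carrier, isModel := H N c hc }

theorem realize_con {T : RegTheory L} {M : Mod.{u, v, w} T}
    (N : Mod.{max u w, v, w} (T.ofModel M)) [L.Structure N.carrier]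
    [(L.lhomWithConstants M.carrier).IsExpansionOn N.carrier] {n : ℕ} (φ : RegFormula L n)
    (hφ : φ.IsHorn) (d : Fin n → M.carrier) (hd : φ.Realize d) :
    φ.Realize fun i => (L.con (d i) : N.carrier) :=
  (realize_subst_con φ d _).1
    (N.isModel _ (Or.inr ⟨n, φ, d, hφ, hd, rfl⟩) (fun i => i.elim0) trivial)

/-- The homomorphism from `M` to a model of the theory of `M` given by the constants. -/
def constHom {T : RegTheory L} {M : Mod.{u, v, w} T} (N : Mod.{max u w, v, w} (T.ofModel M)) :
    M ⟶ reductMod N :=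
  letI : L.Structure N.carrier := (L.lhomWithConstants M.carrier).reduct N.carrier
  show M.carrier →[L] N.carrier from
  { toFun := fun d => (L.con d : N.carrier)
    map_fun' := fun {n} f d => by
      -- The graph of `f` is given by the atomic formula `f(x) = y`, so the diagram also controls
      -- function symbols.
      have := realize_con N (equal (Term.func f fun i => Term.var i.castSucc)
        (Term.var (Fin.last n))) trivial
        (Fin.snoc (α := fun _ => M.carrier) d (Structure.funMap f d)) (by simp [Realize])
      simp only [Realize, Term.realize_func, Term.realize_var, Fin.snoc_castSucc,
        Fin.snoc_last] at this
      exact this.symm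
    map_rel' := fun {n} R d hd =>
      realize_con N (RegFormula.rel R fun i => Term.var i) trivial d hd }

end Diagram

/-! ### From truth along all homomorphisms to a regular formula -/

section Foralls

open SynHom

variable {L : FirstOrder.Language.{u, v}}

/-- If all images of `y` under homomorphisms satisfy `∀_f φ`, then this is due to a regular
formula that is true of `y`. -/
theorem IsStronglyConservative.exists_formula {T : RegTheory L}
    {𝓜 : ObjectProperty (Mod.{u, v, w} T)} (h : IsStronglyConservative T 𝓜) {A B : SynCat T}
    (f : A ⟶ B) (φ : RegFormula L A.ctx) {M : Mod.{u, v, w} T} (hM : 𝓜 M) (y : Extension B M)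
    (H : ∀ N, 𝓜 N → ∀ (g : M ⟶ N) (x : Extension A N),
      eval f N x = Extension.map g y → φ.Realize x.1) :
    ∃ ψ : RegFormula L B.ctx, ψ.Realize y.1 ∧
      ∀ (N : Mod.{u, v, w} T) (x : Extension A N),
        ψ.Realize (eval f N x).1 → φ.Realize x.1 := by
  -- This is the sequent `f(x) = y ⊢ φ(x)`, with the entries of `y` as constants.
  let σ : Sequent L[[M.carrier]] := ⟨A.ctx,
    subst₂ ((rel f).onLHom (L.lhomWithConstants M.carrier)) Term.var
      (fun j => (L.con (y.1 j)).term),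
    φ.onLHom (L.lhomWithConstants M.carrier)⟩
  -- Strong conservativity applies: in a model of `T_M` with reduct in `𝓜`, `H` can be used for the
  -- homomorphism `constHom N`.
  have hσ : Derives (T.ofModel M) σ.hyp σ.concl := by
    refine h.2 M hM σ fun N hN x hx => ?_
    let : L.Structure N.carrier := (L.lhomWithConstants M.carrier).reduct N.carrier
    have hx' := (realize_onLHom (L.lhomWithConstants M.carrier) _ _).1 ((realize_subst₂ _ _ _ _).1 hx)
    simp only [Term.realize_var, Term.realize_constants] at hx'
    obtain ⟨x', hxx, hy⟩ := (realize_rel f (reductMod N) _ _).1 hx'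
    obtain rfl : x'.1 = x := hxx
    have hφ : φ.Realize (M := N.carrier) x'.1 := H _ hN (constHom N) x' (Subtype.ext hy)
    exact (realize_onLHom (L.lhomWithConstants M.carrier) φ _).2 hφ
  obtain ⟨k, χ, e, hk, he, hc⟩ := hσ.isTrueVia
  let E : Fin (B.ctx + k) → M.carrier := Fin.append y.1 e
  -- For each element listed by `E`, `s` selects one of its positions. Unlisted elements get an
  -- arbitrary position, which exists because `0 < k` when `M` is inhabited.
  obtain ⟨s, hs⟩ : ∃ s : M.carrier → Fin (B.ctx + k), ∀ i, E (s (E i)) = E i := by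
    by_cases hM : Nonempty M.carrier
    · have : Nonempty (Fin (B.ctx + k)) := ⟨⟨0, Nat.add_pos_right _ (hk hM)⟩⟩
      exact ⟨Function.invFun E, fun i => Function.invFun_eq ⟨i, rfl⟩⟩
    · exact ⟨fun d => (hM ⟨d⟩).elim, fun i => (hM ⟨E i⟩).elim⟩
  -- The formula is `∃ z, χ(z)` together with equations forcing positions of `(y, z)` with the same
  -- entry in `E` to agree. Without them, repeated elements of `M` could receive conflicting values
  -- in `N`.
  refine ⟨exs k (and (χ.subst (vars B.ctx k))
    (eqs (B.ctx + k) Term.var fun i => Term.var (s (E i)))), ?_, fun N x hx => ?_⟩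
  · rw [realize_exs]
    refine ⟨e, ?_⟩
    simp only [Realize, realize_subst, realize_eqs, vars, Term.realize_var, Fin.append_right]
    exact ⟨he, fun j => (hs j).symm⟩
  · obtain ⟨z, hz⟩ := (realize_exs _ _ _).1 hx
    simp only [Realize, realize_subst, realize_eqs, vars, Term.realize_var,
      Fin.append_right] at hz
    -- Each constant denotes the value at its selected position; the equations then give the entries
    -- of `y` and `e` their intended values.
    let c : M.carrier → N.carrier := fun d => Fin.append (eval f N x).1 z (s d)
    have hce : (fun i => c (e i)) = z := funext fun i => by
      simpa [E] using (hz.2 (Fin.natAdd _ i)).symm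
    have hcy : (fun i => c (y.1 i)) = (eval f N x).1 := funext fun i => by
      simpa [E] using (hz.2 (Fin.castAdd _ i)).symm
    have hN := hc N c (by rw [hce]; exact hz.1)
    let := constantsOn.structure c
    refine (realize_onLHom (L.lhomWithConstants M.carrier) φ _).1 (hN x.1 ((realize_subst₂ _ _ _ _).2
      ((realize_onLHom (L.lhomWithConstants M.carrier) _ _).2 ?_)))
    simp only [Term.realize_var, Term.realize_constants]
    exact (realize_rel_extension f N x _).2 hcy.symm

end Foralls

/-! ### Universal quantification for set-valued functors -/

section SubfunctorForall

open Limits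

variable {C : Type u₁} [Category.{v₁} C] {F G : C ⥤ Type w}

/-- Universal quantification of subfunctors along a natural transformation. -/
def subfunctorForall (α : F ⟶ G) (S : Subfunctor F) : Subfunctor G where
  -- Quantifying over all `i`, and not only over the fibre at `U`, makes the result stable under
  -- `G.map`.
  obj U := {y | ∀ (V : C) (i : U ⟶ V) (x : F.obj V), α.app V x = G.map i y → x ∈ S.obj V}
  map {U V} i y hy W j x hx := hy W (i ≫ j) x (by simpa using hx)

/-- Membership in `H` persists along every `i`, which gives one direction; the other is the case `i
= 𝟙 U`. -/
theorem preimage_le_iff_le_subfunctorForall (α : F ⟶ G) (H : Subfunctor G) (S : Subfunctor F) :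
    H.preimage α ≤ S ↔ H ≤ subfunctorForall α S := by
  constructor
  · intro h U y hy V i x hx
    refine h V ?_
    change α.app V x ∈ H.obj V
    rw [hx]
    exact H.map i hy
  · intro h U x hx
    exact h U hx U (𝟙 U) x (by simp)

/-- Evaluation at an object preserves pullbacks, so this reduces to pullbacks of sets. -/
theorem range_pullback_arrow (α : F ⟶ G) (X : Subobject G) :
    Subfunctor.range ((Subobject.pullback α).obj X).arrow =
      (Subfunctor.range X.arrow).preimage α := by
  ext U x
  have sq := (Subobject.isPullback α X).map ((evaluation C (Type w)).obj U)
  constructor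
  · rintro ⟨z, rfl⟩
    exact ⟨_, ConcreteCategory.congr_hom sq.w z⟩
  · rintro ⟨z, hz⟩
    obtain ⟨p, -, hp⟩ := Types.exists_of_isPullback sq z x hz
    exact ⟨p, hp⟩

theorem subobject_le_iff_range_le {X Y : Subobject F} :
    X ≤ Y ↔ Subfunctor.range X.arrow ≤ Subfunctor.range Y.arrow :=
  ((Subfunctor.orderIsoSubobject F).symm.le_iff_le).symm

/-- Universal quantification of subobjects in a category of set-valued functors. -/
noncomputable def subobjectForall (α : F ⟶ G) : Subobject F ⥤ Subobject G :=
  Monotone.functor (f := fun S => Subobject.mk (subfunctorForall α (Subfunctor.range S.arrow)).ι)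
    fun S S' h => by
      rw [subobject_le_iff_range_le, Subfunctor.range_subobjectMk_ι,
        Subfunctor.range_subobjectMk_ι, ← preimage_le_iff_le_subfunctorForall]
      exact ((preimage_le_iff_le_subfunctorForall α _ _).2 le_rfl).trans
        (subobject_le_iff_range_le.1 h)

theorem range_subobjectForall_arrow (α : F ⟶ G) (S : Subobject F) :
    Subfunctor.range ((subobjectForall α).obj S).arrow =
      subfunctorForall α (Subfunctor.range S.arrow) :=
  Subfunctor.range_subobjectMk_ι _

/-- `subobjectForall` is right adjoint to the pullback of subobjects. -/
noncomputable def subobjectForallAdjunction (α : F ⟶ G) :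
    Subobject.pullback α ⊣ subobjectForall α :=
  have gc : ∀ X S, (Subobject.pullback α).obj X ≤ S ↔ X ≤ (subobjectForall α).obj S := by
    intro X S
    rw [subobject_le_iff_range_le, subobject_le_iff_range_le, range_pullback_arrow,
      range_subobjectForall_arrow, preimage_le_iff_le_subfunctorForall]
  Adjunction.mkOfHomEquiv
    { homEquiv := fun X S =>
        { toFun := fun h => homOfLE ((gc X S).1 (leOfHom h))
          invFun := fun h => homOfLE ((gc X S).2 (leOfHom h))
          left_inv := fun _ => Subsingleton.elim _ _
          right_inv := fun _ => Subsingleton.elim _ _ }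
      homEquiv_naturality_left_symm := fun _ _ => Subsingleton.elim _ _
      homEquiv_naturality_right := fun _ _ => Subsingleton.elim _ _ }

end SubfunctorForall

/-! ### Preservation of universal quantification by `Ev` -/

section Main

variable {L : FirstOrder.Language.{u, v}} {T : RegTheory L}
  {𝓜 : ObjectProperty (Mod.{u, v, w} T)}

open SynHom Limits

/-- Since `Ev` preserves monomorphisms, `S'.arrow` is pointwise injective, and `exists_lift` yields
the factorization. -/
theorem IsConservativeFor.subobject_le (h : IsConservativeFor T 𝓜) {A : SynCat T}
    {S S' : Subobject A} (H : ∀ M, 𝓜 M → Set.range (eval S.arrow M) ⊆ Set.range (eval S'.arrow M)) :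
    S ≤ S' := by
  have := h.hasFiniteLimits
  have := h.preservesFiniteLimits_Ev
  have hinj : ∀ M, 𝓜 M → Function.Injective (eval S'.arrow M) := fun M hM =>
    (mono_iff_injective (((Ev 𝓜).map S'.arrow).app ⟨M, hM⟩)).1 inferInstance
  obtain ⟨e, he⟩ := h.exists_lift S.arrow S'.arrow hinj fun M hM x => H M hM ⟨x, rfl⟩
  exact Subobject.le_of_comm e he

theorem range_mapSub_arrow [(Ev 𝓜).PreservesMonomorphisms]
    {A : SynCat T} (S : Subobject A) :
    Subfunctor.range (mapSub (Ev 𝓜) S).arrow = Subfunctor.range ((Ev 𝓜).map S.arrow) := by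
  have e := Subobject.underlyingIso_hom_comp_eq_mk ((Ev 𝓜).map S.arrow)
  have e' := Subobject.underlyingIso_arrow ((Ev 𝓜).map S.arrow)
  refine le_antisymm ?_ ?_
  · conv_lhs => rw [mapSub, ← e]
    exact Subfunctor.range_comp_le _ _
  · conv_lhs => rw [← e']
    exact Subfunctor.range_comp_le _ _

theorem IsConservativeFor.mem_range_pullback_arrow [HasPullbacks (SynCat T)]
    (h : IsConservativeFor T 𝓜) {A B : SynCat T} (f : A ⟶ B)
    (V : Subobject B) {M : Mod.{u, v, w} T} (hM : 𝓜 M) (x : Extension A M) :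
    x ∈ Set.range (eval ((Subobject.pullback f).obj V).arrow M) ↔
      eval f M x ∈ Set.range (eval V.arrow M) := by
  have sq := Subobject.isPullback f V
  constructor
  · rintro ⟨z, rfl⟩
    exact ⟨eval (Subobject.pullbackπ f V) M z, by rw [← eval_comp, ← eval_comp, sq.w]⟩
  · rintro ⟨z, hz⟩
    obtain ⟨p, -, hp⟩ := (h.eval_of_isPullback sq hM).2 z x hz
    exact ⟨p, hp⟩

theorem IsStronglyConservative.preservesForalls_Ev [HasPullbacks (SynCat T)]
    [(Ev 𝓜).PreservesMonomorphisms] (h : IsStronglyConservative T 𝓜) :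
    PreservesForalls (Ev 𝓜) := by
  intro A B f R adj
  refine ⟨subobjectForall _, ⟨subobjectForallAdjunction _⟩, fun S => ?_⟩
  refine le_antisymm ?_ ?_
  -- After transposition this is the image under `Ev` of the counit `f^* (∀_f S) ≤ S`.
  · refine leOfHom ((subobjectForallAdjunction _).homEquiv _ _ (homOfLE ?_))
    rw [subobject_le_iff_range_le, range_pullback_arrow, range_mapSub_arrow, range_mapSub_arrow]
    intro M x hx
    have hx' := (h.1.mem_range_pullback_arrow f (R.obj S) M.2 x).2 hx
    obtain ⟨z, rfl⟩ := hx'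
    have le : (Subobject.pullback f).obj (R.obj S) ≤ S := leOfHom (adj.counit.app S)
    exact ⟨eval (Subobject.ofLE _ _ le) M.1 z, by
      refine (eval_comp _ _ _ _).symm.trans ?_
      rw [Subobject.ofLE_arrow]
      rfl⟩
  · rw [subobject_le_iff_range_le, range_subobjectForall_arrow, range_mapSub_arrow,
      range_mapSub_arrow]
    intro M y hy
    -- Membership of `y` in the semantic `∀` is a statement about all morphisms of `𝓜` out of `M`,
    -- exactly what `exists_formula` requires.
    obtain ⟨ψ, hψ, hψ'⟩ := h.exists_formula f (imgFormula S.arrow) M.2 y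
      fun N hN g x hx => by
        obtain ⟨z, hz⟩ := hy ⟨N, hN⟩ ⟨g⟩ x hx
        exact (realize_imgFormula _ _ _).2 ⟨z, congrArg Subtype.val hz⟩
    obtain ⟨V, m, hm⟩ := h.1.exists_sub B ψ
    have := h.1.mono m fun M hM => (hm M hM).1
    have hV : ∀ N, 𝓜 N → ∀ y, y ∈ Set.range (eval (Subobject.mk m).arrow N) ↔
        ψ.Realize y.1 := by
      intro N hN y
      rw [← (hm N hN).2]
      constructor
      · rintro ⟨z, rfl⟩
        exact ⟨eval (Subobject.underlyingIso m).hom N z, by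
          rw [← eval_comp, Subobject.underlyingIso_hom_comp_eq_mk]⟩
      · rintro ⟨z, rfl⟩
        exact ⟨eval (Subobject.underlyingIso m).inv N z, by
          rw [← eval_comp, Subobject.underlyingIso_arrow]⟩
    have le : (Subobject.pullback f).obj (Subobject.mk m) ≤ S := by
      refine h.1.subobject_le fun N hN x hx => ?_
      rw [h.1.mem_range_pullback_arrow f _ hN, hV N hN] at hx
      obtain ⟨z, hz⟩ := (realize_imgFormula _ _ _).1 (hψ' N x hx)
      exact ⟨z, Subtype.ext hz⟩
    -- The universal property of the given `∀_f` places the subobject defined by `ψ`, which contains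
    -- `y`, below `∀_f S`.
    have le' : Subobject.mk m ≤ R.obj S := leOfHom (adj.homEquiv _ _ (homOfLE le))
    obtain ⟨z, hz⟩ := (hV M.1 M.2 y).2 hψ
    exact ⟨eval (Subobject.ofLE _ _ le') M.1 z, by
      refine (eval_comp _ _ _ _).symm.trans ?_
      rw [Subobject.ofLE_arrow]
      exact hz⟩

end Main

end RegularLogic

theorem mainTheorem1 {L : FirstOrder.Language.{u, v}} (T : RegularLogic.RegTheory L)
    (𝓜 : CategoryTheory.ObjectProperty (RegularLogic.Mod.{u, v, w} T))
    (h : RegularLogic.IsStronglyConservative T 𝓜) :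
    RegularLogic.IsConservative (RegularLogic.Ev 𝓜) ∧
      RegularLogic.IsConditionallySubHeyting (RegularLogic.Ev 𝓜) :=
  ⟨h.1.isConservative_Ev, h.1.regular, h.1.preservesFiniteLimits_Ev,
    fun _ _ f hf => h.1.isRegularEpi_map_Ev f hf,
    have := h.1.regular
    have := h.1.preservesFiniteLimits_Ev
    h.preservesForalls_Ev⟩
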